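/- Let $k$ be a field, let $H$ and $Q$ be finite-dimensional Hopf algebras over $k$, and let $\pi : H \to Q$ be a surjective morphism of Hopf algebras. Let $\mathcal C = \mathrm{Rep}(H)$ be the monoidal category of finite-dimensional left $H$-modules, and regard $\mathcal D = \mathrm{Rep}(Q)$ as a tensor subcategory of $\mathcal C$ by restriction along $\pi$. For $M\in\mathcal C$ let $M^*$ be the dual with action $(h f)(m) = f(S(h)m)$ and ${}^*M$ the dual with action $(hf)(m) = f(S^{-1}(h)m)$. The relative adjoint algebra $\mathcal A(\mathcal D)$ is the algebra in the Drinfeld center $Z(\mathcal C)$ defined as follows. The reversed category $\mathcal D^{\mathrm{rev}}$ acts on $\mathcal C$ by $X \triangleright M = M\otimes X$, and the functor $S : \mathcal C^{\mathrm{op}}\times\mathcal C\to\mathcal C$, $S(M,N) = N\otimes M^*$, has the prebalancing $$\beta^X_{M,N} : (N\otimes X)\otimes M^* \cong N\otimes (X\otimes M^*) \cong N\otimes(M\otimes {}^*X)^*,\qquad X\in\mathcal D,\ M,N\in\mathcal C .$$ The underlying object of $\mathcal A(\mathcal D)$ is the relative end of $(S,\beta)$: it carries dinatural transformations $\pi_M:\mathcal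 A(\mathcal D)\to M\otimes M^*$ with $$S(\mathrm{ev}_X\triangleright \mathrm{id}_M,\mathrm{id}_M)\,\pi_M = S(m_{X^\vee,X,M},\mathrm{id}_M)\,\beta^X_{X\triangleright M,M}\,\pi_{X\triangleright M}\qquad (X\in\mathcal D,\ M\in\mathcal C),$$ where $X^\vee={}^*X$ is the dual of $X$ in $\mathcal D^{\mathrm{rev}}$, $\mathrm{ev}_X$ is its evaluation and $m$ is the associativity constraint of the action, and it is universal with this property. Its product $m$ and unit $u$ are given by $\pi_M\circ m = \mathrm{comp}_M\circ(\pi_M\otimes\pi_M)$, with $\mathrm{comp}_M = \mathrm{id}_M\otimes \mathrm{ev}_M\otimes \mathrm{id}_{M^*}$, and $\pi_M\circ u=\mathrm{coev}_M$, and its half-braiding $\sigma_X : \mathcal A(\mathcal D)\otimes X\to X\otimes\mathcal A(\mathcal D)$ by $$(\mathrm{id}_X\otimes\pi_M)\,\sigma_X = \mathfrak a\,\mathfrak b\,(\pi_{X\otimes M}\otimes\mathrm{id}_X),$$ where $\mathfrak b : ((X\otimes M)\otimes(X\otimes M)^*)\otimes X\to (X\otimes M)\otimes M^*$ is the canonical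 isomorphism $(X\otimes M)^*\cong M^*\otimes X^*$ followed by the evaluation of $X$, and $\mathfrak a:(X\otimes M)\otimes M^*\to X\otimes(M\otimes M^*)$ is the associativity. Then $\mathcal A(\mathcal D)$ exists, and there is an isomorphism $$\mathcal A(\mathcal D)\;\cong\; H^{co\,\pi} = \{h\in H : h_1\otimes\pi(h_2) = h\otimes 1\}$$ of algebras in $Z(\mathcal C)$, where $H^{co\,\pi}$ is a subalgebra of $H$ with the adjoint action $h\triangleright a = h_1\, a\, S(h_2)$ and the half-braiding $\sigma_X(a\otimes x) = a_1 x\otimes a_2$. Under this isomorphism $\pi_M(a)\in M\otimes M^*\cong \mathrm{End}_k(M)$ is the action of $a$ on $M$. -/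

import Mathlib

open scoped TensorProduct

universe u v

namespace Sweedler
noncomputable section
variable {k : Type u} {H : Type u} [Field k] [Ring H] [HopfAlgebra k H]
  {W : Type v} [AddCommGroup W] [Module k W]

open Coalgebra HopfAlgebra

variable (k) in
/-- The terms `(h₁, h₂)` of a chosen expression `∑ h₁ ⊗ h₂` of the comultiplication of `h`. -/
def sw (h : H) : Finset (H × H) :=
  (TensorProduct.exists_finset (R := k) (comul h : H ⊗[k] H)).choose

lemma sw_spec (h : H) : (comul h : H ⊗[k] H) = ∑ p ∈ sw k h, p.1 ⊗ₜ[k] p.2 :=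
  (TensorProduct.exists_finset (R := k) (comul h : H ⊗[k] H)).choose_spec

lemma lift_comul (F : H →ₗ[k] H →ₗ[k] W) (h : H) :
    TensorProduct.lift F (comul h) = ∑ p ∈ sw k h, F p.1 p.2 := by
  simp [sw_spec]

lemma coassoc (F : H →ₗ[k] H →ₗ[k] H →ₗ[k] W) (h : H) :
    ∑ p ∈ sw k h, ∑ q ∈ sw k p.1, F q.1 q.2 p.2 =
    ∑ p ∈ sw k h, ∑ q ∈ sw k p.2, F p.1 q.1 q.2 := by
  have := congrArg (TensorProduct.lift ((TensorProduct.uncurry (.id k) H H W) ∘ₗ F))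
    (Coalgebra.coassoc_apply (R := k) h)
  simpa [sw_spec, map_sum, TensorProduct.sum_tmul, TensorProduct.tmul_sum] using this

lemma counit_left (F : H →ₗ[k] W) (h : H) :
    ∑ p ∈ sw k h, counit (R := k) p.1 • F p.2 = F h := by
  have := congrArg (TensorProduct.lift (LinearMap.lsmul k W) ∘ₗ F.lTensor k)
    (Coalgebra.rTensor_counit_comul (R := k) h)
  simpa [sw_spec, map_sum] using this

lemma counit_right (F : H →ₗ[k] W) (h : H) :
    ∑ p ∈ sw k h, counit (R := k) p.2 • F p.1 = F h := by
  have := congrArg (TensorProduct.lift (LinearMap.lsmul k W).flip ∘ₗ F.rTensor k)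
    (Coalgebra.lTensor_counit_comul (R := k) h)
  simpa [sw_spec, map_sum] using this

lemma sw_mul (F : H →ₗ[k] H →ₗ[k] W) (a b : H) :
    ∑ p ∈ sw k (a * b), F p.1 p.2 =
      ∑ p ∈ sw k a, ∑ q ∈ sw k b, F (p.1 * q.1) (p.2 * q.2) := by
  rw [← lift_comul, Bialgebra.comul_mul, sw_spec a, sw_spec b]
  simp [Finset.sum_mul_sum]

lemma sw_antipode_mul (h : H) :
    ∑ p ∈ sw k h, antipode k p.1 * p.2 = algebraMap k H (counit h) := by
  rw [← mul_antipode_rTensor_comul_apply, sw_spec h]; simp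

lemma sw_mul_antipode (h : H) :
    ∑ p ∈ sw k h, p.1 * antipode k p.2 = algebraMap k H (counit h) := by
  rw [← mul_antipode_lTensor_comul_apply, sw_spec h]; simp

/-- Trilinear functions, from functions linear in each variable. -/
def tri (F : H → H → H → W) (h1 : ∀ y z, IsLinearMap k (fun x => F x y z))
    (h2 : ∀ x z, IsLinearMap k (fun y => F x y z)) (h3 : ∀ x y, IsLinearMap k (F x y)) :
    H →ₗ[k] H →ₗ[k] H →ₗ[k] W :=
  LinearMap.mk₂ k (fun x y => (h3 x y).mk' _)
    (fun x x' y => by ext z; exact (h1 y z).map_add x x')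
    (fun c x y => by ext z; exact (h1 y z).map_smul c x)
    (fun x y y' => by ext z; exact (h2 x z).map_add y y')
    (fun c x y => by ext z; exact (h2 x z).map_smul c y)

lemma coassoc' (F : H → H → H → W) (h1 : ∀ y z, IsLinearMap k (fun x => F x y z))
    (h2 : ∀ x z, IsLinearMap k (fun y => F x y z)) (h3 : ∀ x y, IsLinearMap k (F x y)) (h : H) :
    ∑ p ∈ sw k h, ∑ q ∈ sw k p.1, F q.1 q.2 p.2 =
    ∑ p ∈ sw k h, ∑ q ∈ sw k p.2, F p.1 q.1 q.2 :=
  coassoc (tri F h1 h2 h3) h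

/-- The map `e ↦ g(e₂) e₁`. -/
def slice (g : H →ₗ[k] k) : H →ₗ[k] H :=
  (TensorProduct.rid k H).toLinearMap ∘ₗ g.lTensor H ∘ₗ comul

lemma slice_apply (g : H →ₗ[k] k) (e : H) : slice g e = ∑ p ∈ sw k e, g p.2 • p.1 := by
  simp [slice, sw_spec e]

lemma slice_add (g g' : H →ₗ[k] k) (e : H) : slice (g + g') e = slice g e + slice g' e := by
  simp [slice_apply, add_smul, Finset.sum_add_distrib]

/-- The map `b ↦ S(S(b)) x`. -/
def sqMul (x : H) : H →ₗ[k] H := LinearMap.mulRight k x ∘ₗ antipode k ∘ₗ antipode k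

lemma sqMul_apply (x b : H) : sqMul (k := k) x b = antipode k (antipode k b) * x := rfl

lemma mul_slice (f : H →ₗ[k] k) (x h e : H) :
    h * slice (f ∘ₗ sqMul x) e =
      ∑ r ∈ sw k h, slice (f ∘ₗ LinearMap.mulLeft k (antipode k r.2) ∘ₗ sqMul x) (r.1 * e) := by
  have h1 : ∀ r : H × H,
      slice (f ∘ₗ LinearMap.mulLeft k (antipode k r.2) ∘ₗ sqMul x) (r.1 * e) =
      ∑ s ∈ sw k r.1, ∑ p ∈ sw k e,
        f (antipode k r.2 * (antipode k (antipode k (s.2 * p.2)) * x)) • (s.1 * p.1) := by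
    intro r
    have := sw_mul (k := k) (LinearMap.mk₂ k (fun a b : H =>
      f (antipode k r.2 * (antipode k (antipode k b) * x)) • a)
      (by intros; simp) (by intros; simp [smul_smul, mul_comm])
      (by intros; simp [add_mul, mul_add, add_smul]) (by intros; simp [smul_smul])) r.1 e
    simpa [slice_apply, sqMul_apply] using this
  simp_rw [h1]
  rw [coassoc' (fun a b c => ∑ p ∈ sw k e,
        f (antipode k c * (antipode k (antipode k (b * p.2)) * x)) • (a * p.1))]
  · have h2 : ∀ r : H × H, (∑ s ∈ sw k r.2, ∑ p ∈ sw k e,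
        f (antipode k s.2 * (antipode k (antipode k (s.1 * p.2)) * x)) • (r.1 * p.1)) =
        counit (R := k) r.2 • (r.1 * slice (f ∘ₗ sqMul x) e) := by
      intro r
      rw [Finset.sum_comm, slice_apply, Finset.mul_sum, Finset.smul_sum]
      refine Finset.sum_congr rfl fun p _ => ?_
      rw [← Finset.sum_smul, ← map_sum]
      have : ∑ s ∈ sw k r.2, antipode k s.2 * (antipode k (antipode k (s.1 * p.2)) * x) =
          counit (R := k) r.2 • (antipode k (antipode k p.2) * x) := by
        have h3 := congrArg (antipode k) (sw_antipode_mul (k := k) r.2)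
        simp only [map_sum, antipode_mul_antidistrib, Algebra.algebraMap_eq_smul_one,
          map_smul, antipode_one] at h3
        simp only [antipode_mul_antidistrib]
        simp only [← mul_assoc]
        rw [← Finset.sum_mul, ← Finset.sum_mul, h3]
        simp
      rw [this]
      simp [sqMul_apply, smul_smul]
    simp_rw [h2]
    exact (counit_right (LinearMap.mulRight k (slice (f ∘ₗ sqMul x) e)) h).symm
  all_goals
    intros
    constructor <;> intros <;>
      simp [add_mul, mul_add, add_smul, Finset.sum_add_distrib, Finset.smul_sum, smul_smul, mul_comm]

variable [FiniteDimensional k H]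

lemma coord_expand (g : H →ₗ[k] W) (x : H) :
    ∑ j, (Module.finBasis k H).coord j x • g (Module.finBasis k H j) = g x := by
  conv_rhs => rw [← (Module.finBasis k H).sum_repr x]
  rw [map_sum]
  simp only [map_smul]
  rfl

lemma sum_coord_slice (G : H →ₗ[k] H) (a c : H) :
    ∑ i, slice (((Module.finBasis k H).coord i) ∘ₗ LinearMap.mulLeft k c ∘ₗ G)
      (a * Module.finBasis k H i) =
    ∑ i, slice (((Module.finBasis k H).coord i) ∘ₗ G) (a * (c * Module.finBasis k H i)) := by
  set b := Module.finBasis k H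
  have h1 : ∀ i, slice ((b.coord i) ∘ₗ LinearMap.mulLeft k c ∘ₗ G) (a * b i) =
      ∑ j, b.coord i (c * b j) • slice (b.coord j ∘ₗ G) (a * b i) := by
    intro i
    simp only [slice_apply, Finset.smul_sum]
    rw [Finset.sum_comm]
    refine Finset.sum_congr rfl fun p _ => ?_
    simp only [smul_smul]
    rw [← Finset.sum_smul]
    congr 1
    have := coord_expand (k := k) (b.coord i ∘ₗ LinearMap.mulLeft k c) (G p.2)
    simpa [mul_comm] using this.symm
  simp_rw [h1]
  rw [Finset.sum_comm]
  refine Finset.sum_congr rfl fun j _ => ?_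
  have := coord_expand (k := k) (slice (b.coord j ∘ₗ G) ∘ₗ LinearMap.mulLeft k a) (c * b j)
  simpa using this

/-- A left integral of a finite-dimensional Hopf algebra, given by a trace formula. -/
def integral (x : H) : H :=
  ∑ i, slice (k := k) (((Module.finBasis k H).coord i) ∘ₗ sqMul x) (Module.finBasis k H i)

lemma mul_integral (h x : H) :
    h * integral (k := k) x = counit (R := k) h • integral (k := k) x := by
  simp only [integral, Finset.mul_sum, mul_slice]
  rw [Finset.sum_comm]
  simp_rw [sum_coord_slice]
  rw [Finset.sum_comm, Finset.smul_sum]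
  refine Finset.sum_congr rfl fun i _ => ?_
  simp_rw [← mul_assoc]
  rw [← map_sum, ← Finset.sum_mul, sw_mul_antipode]
  simp [Algebra.algebraMap_eq_smul_one]

lemma exists_integral [Nontrivial H] : ∃ x : H, integral (k := k) x ≠ 0 := by
  by_contra! hx
  set b := Module.finBasis k H
  have key : ∀ y : H, y = 0 := by
    intro y
    -- the linear map `e ↦ f(S(e₂) y) e₁`
    let P (f : H →ₗ[k] k) : H →ₗ[k] H := slice (f ∘ₗ LinearMap.mulRight k y ∘ₗ antipode k)
    have h0 : ∑ j, P (b.coord j) (integral (k := k) (b j)) = 0 := by simp [hx]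
    have h1 : ∀ i, ∑ j, P (b.coord j) (slice ((b.coord i) ∘ₗ sqMul (b j)) (b i)) =
        b.coord i y • b i := by
      intro i
      have h2 : ∀ j, P (b.coord j) (slice ((b.coord i) ∘ₗ sqMul (b j)) (b i)) =
          ∑ p ∈ sw k (b i), ∑ q ∈ sw k p.1,
            (b.coord i (antipode k (antipode k p.2) * b j) * b.coord j (antipode k q.2 * y)) • q.1 := by
        intro j
        simp only [P, slice_apply, map_sum, map_smul, Finset.smul_sum, smul_smul]
        rfl
      simp_rw [h2]
      rw [Finset.sum_comm]
      have h3 : ∀ p : H × H, (∑ j, ∑ q ∈ sw k p.1,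
            (b.coord i (antipode k (antipode k p.2) * b j) * b.coord j (antipode k q.2 * y)) • q.1) =
          ∑ q ∈ sw k p.1,
            b.coord i (antipode k (antipode k p.2) * (antipode k q.2 * y)) • q.1 := by
        intro p
        rw [Finset.sum_comm]
        refine Finset.sum_congr rfl fun q _ => ?_
        rw [← Finset.sum_smul]
        congr 1
        have := coord_expand (k := k)
          (b.coord i ∘ₗ LinearMap.mulLeft k (antipode k (antipode k p.2))) (antipode k q.2 * y)
        simpa [mul_comm] using this
      simp_rw [h3]
      rw [coassoc' (fun x y' z => b.coord i (antipode k (antipode k z) * (antipode k y' * y)) • x)]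
      · have h4 : ∀ p : H × H, (∑ q ∈ sw k p.2,
            b.coord i (antipode k (antipode k q.2) * (antipode k q.1 * y)) • p.1) =
            counit (R := k) p.2 • (b.coord i y • p.1) := by
          intro p
          rw [← Finset.sum_smul, ← map_sum]
          have h5 := congrArg (antipode k) (sw_mul_antipode (k := k) p.2)
          simp only [map_sum, antipode_mul_antidistrib, Algebra.algebraMap_eq_smul_one,
            map_smul, antipode_one] at h5
          simp only [← mul_assoc]
          rw [← Finset.sum_mul, h5]
          simp [smul_smul]
        simp_rw [h4]
        simpa using (counit_right (LinearMap.lsmul k H (b.coord i y)) (b i))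
      all_goals
        intros
        constructor <;> intros <;>
          simp [add_mul, mul_add, add_smul, smul_smul, mul_comm]
    have h6 : ∑ j, P (b.coord j) (integral (k := k) (b j)) = y := by
      simp only [integral, map_sum]
      rw [Finset.sum_comm]
      simp_rw [b] at h1 ⊢
      simp_rw [h1]
      exact (Module.finBasis k H).sum_repr y
    rw [← h6, h0]
  exact one_ne_zero (key 1)

lemma integral_comm (t : H) (ht : ∀ h : H, h * t = counit (R := k) h • t) (z : H) :
    ∑ p ∈ sw k t, (z * p.1) ⊗ₜ[k] (antipode k p.2 : H) =
      ∑ p ∈ sw k t, p.1 ⊗ₜ[k] (antipode k p.2 * z) := by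
  -- the linear map `u ↦ u₁ ⊗ S(u₂) c`
  let F (c : H) : H →ₗ[k] H ⊗[k] H :=
    (LinearMap.lTensor H (LinearMap.mulRight k c ∘ₗ antipode k)) ∘ₗ comul
  have hF : ∀ c u, F c u = ∑ p ∈ sw k u, p.1 ⊗ₜ[k] (antipode k p.2 * c) := by
    intro c u
    simp [F, sw_spec u]
  have h1 : ∑ r ∈ sw k z, F r.2 (r.1 * t) = F z t := by
    simp_rw [ht, map_smul]
    have := counit_left (k := k) (LinearMap.mk₂ k (fun c u => F c u)
      (by intros; simp [hF, mul_add, TensorProduct.tmul_add, Finset.sum_add_distrib])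
      (by intros; simp [hF, Finset.smul_sum]) (by simp) (by simp) |>.flip t) z
    simpa using this
  have h2 : ∑ r ∈ sw k z, F r.2 (r.1 * t) =
      ∑ r ∈ sw k z, ∑ s ∈ sw k r.1, ∑ p ∈ sw k t,
        (s.1 * p.1) ⊗ₜ[k] (antipode k (s.2 * p.2) * r.2) := by
    refine Finset.sum_congr rfl fun r _ => ?_
    rw [hF]
    have := sw_mul (k := k) (LinearMap.mk₂ k (fun a b : H => a ⊗ₜ[k] (antipode k b * r.2))
      (by intros; simp [TensorProduct.add_tmul]) (by intros; simp [TensorProduct.smul_tmul'])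
      (by intros; simp [add_mul, TensorProduct.tmul_add]) (by intros; simp)) r.1 t
    exact this
  rw [← hF, ← h1, h2,
    coassoc' (fun a b c => ∑ p ∈ sw k t, (a * p.1) ⊗ₜ[k] (antipode k (b * p.2) * c))]
  · have h4 : ∀ r : H × H, (∑ s ∈ sw k r.2, ∑ p ∈ sw k t,
        (r.1 * p.1) ⊗ₜ[k] (antipode k (s.1 * p.2) * s.2)) =
        counit (R := k) r.2 • ∑ p ∈ sw k t, (r.1 * p.1) ⊗ₜ[k] (antipode k p.2 : H) := by
      intro r
      rw [Finset.sum_comm, Finset.smul_sum]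
      refine Finset.sum_congr rfl fun p _ => ?_
      rw [← TensorProduct.tmul_sum]
      simp only [antipode_mul_antidistrib, mul_assoc]
      rw [← Finset.mul_sum, sw_antipode_mul]
      simp [Algebra.algebraMap_eq_smul_one]
    simp_rw [h4]
    have := counit_right (k := k) (W := H ⊗[k] H) ((LinearMap.mk₂ k
      (fun a c : H => ∑ p ∈ sw k t, (a * p.1) ⊗ₜ[k] (antipode k p.2 * c : H))
      (by intros; simp [add_mul, TensorProduct.add_tmul, Finset.sum_add_distrib])
      (by intros; simp [TensorProduct.smul_tmul', Finset.smul_sum])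
      (by intros; simp [mul_add, TensorProduct.tmul_add, Finset.sum_add_distrib])
      (by intros; simp [Finset.smul_sum])).flip 1) z
    simpa using this.symm
  all_goals
    intros
    constructor <;> intros <;>
      simp [add_mul, mul_add, TensorProduct.tmul_add, TensorProduct.add_tmul,
        Finset.sum_add_distrib, Finset.smul_sum, TensorProduct.smul_tmul']

variable (k H) in
/-- The antipode of a finite-dimensional Hopf algebra over a field is bijective. -/
theorem antipode_bijective : Function.Bijective (antipode k : H →ₗ[k] H) := by
  suffices hs : Function.Surjective (antipode k : H →ₗ[k] H) from
    ⟨LinearMap.injective_iff_surjective.mpr hs, hs⟩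
  rcases subsingleton_or_nontrivial H with _ | _
  · exact fun x => ⟨0, Subsingleton.elim _ _⟩
  obtain ⟨x, hx⟩ := exists_integral (k := k) (H := H)
  set t := integral (k := k) x with htdef
  have ht : ∀ h : H, h * t = counit (R := k) h • t := fun h => mul_integral h x
  rw [← LinearMap.range_eq_top]
  by_contra hne
  obtain ⟨f, hf0, hf⟩ := Submodule.exists_dual_map_eq_bot_of_lt_top
    (lt_top_iff_ne_top.mpr hne) inferInstance
  have hfS : ∀ y : H, f (antipode k y) = 0 := by
    intro y
    have : f (antipode k y) ∈ (LinearMap.range (antipode k : H →ₗ[k] H)).map f :=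
      ⟨_, ⟨y, rfl⟩, rfl⟩
    rw [hf] at this
    simpa using this
  have h1 : ∀ z : H, ∑ p ∈ sw k t, f (antipode k p.2 * z) • p.1 = 0 := by
    intro z
    have := congrArg ((TensorProduct.rid k H).toLinearMap ∘ₗ f.lTensor H) (integral_comm t ht z)
    simp only [map_sum, LinearMap.comp_apply, LinearMap.lTensor_tmul, LinearEquiv.coe_coe,
      TensorProduct.rid_tmul, hfS, zero_smul, Finset.sum_const_zero] at this
    exact this.symm
  apply hf0
  ext z
  set b := Module.finBasis k H
  have h2 : ∑ j, slice (b.coord j ∘ₗ sqMul z) (∑ p ∈ sw k t, f (antipode k p.2 * b j) • p.1) = 0 := by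
    simp [h1]
  have h3 : ∑ j, slice (b.coord j ∘ₗ sqMul z) (∑ p ∈ sw k t, f (antipode k p.2 * b j) • p.1) =
      f z • t := by
    simp only [map_sum, map_smul]
    rw [Finset.sum_comm]
    have h4 : ∀ p : H × H, (∑ j, f (antipode k p.2 * b j) • slice (b.coord j ∘ₗ sqMul z) p.1) =
        ∑ q ∈ sw k p.1, f (antipode k p.2 * (antipode k (antipode k q.2) * z)) • q.1 := by
      intro p
      simp only [slice_apply, Finset.smul_sum]
      rw [Finset.sum_comm]
      refine Finset.sum_congr rfl fun q _ => ?_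
      simp only [smul_smul]
      rw [← Finset.sum_smul]
      congr 1
      have := coord_expand (k := k)
        (f ∘ₗ LinearMap.mulLeft k (antipode k p.2)) (antipode k (antipode k q.2) * z)
      simpa [mul_comm, sqMul_apply] using this
    simp_rw [h4]
    rw [coassoc' (fun x y' w => f (antipode k w * (antipode k (antipode k y') * z)) • x)]
    · have h5 : ∀ p : H × H, (∑ q ∈ sw k p.2,
          f (antipode k q.2 * (antipode k (antipode k q.1) * z)) • p.1) =
          counit (R := k) p.2 • (f z • p.1) := by
        intro p
        rw [← Finset.sum_smul, ← map_sum]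
        have h5 := congrArg (antipode k) (sw_antipode_mul (k := k) p.2)
        simp only [map_sum, antipode_mul_antidistrib, Algebra.algebraMap_eq_smul_one,
          map_smul, antipode_one] at h5
        simp only [← mul_assoc]
        rw [← Finset.sum_mul, h5]
        simp [smul_smul]
      simp_rw [h5]
      simpa using (counit_right (LinearMap.lsmul k H (f z)) t)
    all_goals
      intros
      constructor <;> intros <;>
        simp [add_mul, mul_add, add_smul, smul_smul, mul_comm]
  rw [h2] at h3
  simpa [hx] using h3.symm

end
end Sweedler

noncomputable section

open CategoryTheory MonoidalCategory Coalgebra HopfAlgebra Sweedler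

section Actions

variable {k H : Type u} [Field k] [Ring H] [HopfAlgebra k H]
  {V V' V'' : Type u} [AddCommGroup V] [Module k V] [AddCommGroup V'] [Module k V']
  [AddCommGroup V''] [Module k V'']

namespace HopfAction

/-- The action `h (x ⊗ y) = h₁ x ⊗ h₂ y` on a tensor product. -/
def tensor (ρ : H →ₐ[k] Module.End k V) (σ : H →ₐ[k] Module.End k V') :
    H →ₐ[k] Module.End k (V ⊗[k] V') :=
  ((Module.endTensorEndAlgHom (R := k) (S := k) (A := k)).comp
    (Algebra.TensorProduct.map ρ σ)).comp (Bialgebra.comulAlgHom k H)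

lemma tensor_eq (ρ : H →ₐ[k] Module.End k V) (σ : H →ₐ[k] Module.End k V') (h : H) :
    tensor ρ σ h = ∑ p ∈ sw k h, TensorProduct.map (ρ p.1) (σ p.2) := by
  simp [tensor, sw_spec h]
  rfl

lemma tensor_apply (ρ : H →ₐ[k] Module.End k V) (σ : H →ₐ[k] Module.End k V') (h : H)
    (x : V) (y : V') : tensor ρ σ h (x ⊗ₜ y) = ∑ p ∈ sw k h, ρ p.1 x ⊗ₜ[k] σ p.2 y := by
  simp [tensor_eq]

variable (k H) in
/-- The trivial action `h c = ε(h) c`. -/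
def unit : H →ₐ[k] Module.End k k :=
  (Algebra.ofId k (Module.End k k)).comp (Bialgebra.counitAlgHom k H)

lemma unit_apply (h : H) (c : k) : unit k H h c = counit (R := k) h * c := by
  simp [unit, Algebra.ofId_apply, Module.algebraMap_end_apply]

lemma tensor_assoc (ρ : H →ₐ[k] Module.End k V) (σ : H →ₐ[k] Module.End k V')
    (τ : H →ₐ[k] Module.End k V'') (h : H) :
    (TensorProduct.assoc k V V' V'').toLinearMap ∘ₗ tensor (tensor ρ σ) τ h =
      tensor ρ (tensor σ τ) h ∘ₗ (TensorProduct.assoc k V V' V'').toLinearMap := by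
  apply TensorProduct.ext_threefold
  intro x y z
  simp only [LinearMap.comp_apply, LinearEquiv.coe_coe, TensorProduct.assoc_tmul, tensor_apply,
    map_sum, TensorProduct.sum_tmul, TensorProduct.tmul_sum]
  refine coassoc' (fun a b c => ρ a x ⊗ₜ[k] (σ b y ⊗ₜ[k] τ c z)) ?_ ?_ ?_ h <;>
  · intros
    constructor <;> intros <;>
      simp [TensorProduct.tmul_add, TensorProduct.add_tmul, ← TensorProduct.smul_tmul']

lemma tensor_unit_left (ρ : H →ₐ[k] Module.End k V) (h : H) :
    (TensorProduct.lid k V).toLinearMap ∘ₗ tensor (unit k H) ρ h =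
      ρ h ∘ₗ (TensorProduct.lid k V).toLinearMap := by
  apply TensorProduct.ext'
  intro c x
  have := counit_left (k := k) (ρ.toLinearMap.flip (c • x)) h
  simpa [tensor_apply, unit_apply, mul_smul] using this

lemma tensor_unit_right (ρ : H →ₐ[k] Module.End k V) (h : H) :
    (TensorProduct.rid k V).toLinearMap ∘ₗ tensor ρ (unit k H) h =
      ρ h ∘ₗ (TensorProduct.rid k V).toLinearMap := by
  apply TensorProduct.ext'
  intro x c
  have := counit_right (k := k) (ρ.toLinearMap.flip (c • x)) h
  simpa [tensor_apply, unit_apply, mul_smul] using this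

/-- The action `(h f)(x) = f(s(h) x)` on the dual space, for an anti-multiplicative map `s`. -/
def dual (ρ : H →ₐ[k] Module.End k V) (s : H →ₗ[k] H) (s_one : s 1 = 1)
    (s_mul : ∀ a b, s (a * b) = s b * s a) : H →ₐ[k] Module.End k (Module.Dual k V) :=
  AlgHom.ofLinearMap (Module.Dual.transpose ∘ₗ ρ.toLinearMap ∘ₗ s)
    (by ext f x; simp [s_one]; rfl) (fun a b => by ext f x; simp [s_mul]; rfl)

@[simp] lemma dual_apply (ρ : H →ₐ[k] Module.End k V) (s : H →ₗ[k] H) (s_one : s 1 = 1)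
    (s_mul : ∀ a b, s (a * b) = s b * s a) (h : H) (f : Module.Dual k V) (x : V) :
    dual ρ s s_one s_mul h f x = f (ρ (s h) x) := rfl

end HopfAction
end Actions

/-- A finite-dimensional left module over the `k`-algebra `H`. -/
structure FinRep (k H : Type u) [Field k] [Ring H] [Algebra k H] where
  /-- the underlying vector space -/
  V : Type u
  [addCommGroup : AddCommGroup V]
  [module : Module k V]
  [finite : FiniteDimensional k V]
  /-- the action -/
  ρ : H →ₐ[k] Module.End k V

namespace FinRep

attribute [instance] addCommGroup module finite

section Category

variable {k H : Type u} [Field k] [Ring H] [Algebra k H]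

/-- `H`-linear maps. -/
@[ext]
structure Hom (X Y : FinRep k H) where
  /-- the underlying `k`-linear map -/
  lin : X.V →ₗ[k] Y.V
  comm : ∀ h, lin ∘ₗ X.ρ h = Y.ρ h ∘ₗ lin

/-- The category of finite-dimensional left `H`-modules. -/
instance : Category (FinRep k H) where
  Hom X Y := Hom X Y
  id X := ⟨LinearMap.id, fun _ => rfl⟩
  comp f g := ⟨g.lin ∘ₗ f.lin, fun h => by
    rw [LinearMap.comp_assoc, f.comm, ← LinearMap.comp_assoc, g.comm, LinearMap.comp_assoc]⟩

@[ext]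
lemma hom_ext {X Y : FinRep k H} {f g : X ⟶ Y} (h : f.lin = g.lin) : f = g := Hom.ext h

@[simp] lemma id_lin (X : FinRep k H) : (𝟙 X : X ⟶ X).lin = LinearMap.id := rfl

@[simp] lemma comp_lin {X Y Z : FinRep k H} (f : X ⟶ Y) (g : Y ⟶ Z) :
    (f ≫ g).lin = g.lin ∘ₗ f.lin := rfl

lemma lin_apply {X Y : FinRep k H} (f : X ⟶ Y) (h : H) (x : X.V) :
    f.lin (X.ρ h x) = Y.ρ h (f.lin x) := LinearMap.congr_fun (f.comm h) x

/-- An isomorphism of modules from an `H`-linear bijection. -/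
def mkIso {X Y : FinRep k H} (e : X.V ≃ₗ[k] Y.V)
    (he : ∀ h, e.toLinearMap ∘ₗ X.ρ h = Y.ρ h ∘ₗ e.toLinearMap) : X ≅ Y where
  hom := ⟨e.toLinearMap, he⟩
  inv := ⟨e.symm.toLinearMap, fun h => by
    ext y
    apply e.injective
    simpa using (LinearMap.congr_fun (he h) (e.symm y)).symm⟩
  hom_inv_id := by ext x; exact e.symm_apply_apply x
  inv_hom_id := by ext x; exact e.apply_symm_apply x

end Category

section Monoidal

variable {k H : Type u} [Field k] [Ring H] [HopfAlgebra k H]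

/-- The tensor product of modules. -/
abbrev tensor (X Y : FinRep k H) : FinRep k H where
  V := X.V ⊗[k] Y.V
  ρ := HopfAction.tensor X.ρ Y.ρ

/-- The trivial module. -/
abbrev unit : FinRep k H where
  V := k
  ρ := HopfAction.unit k H

/-- The tensor product of morphisms. -/
def tensorMap {X X' Y Y' : FinRep k H} (f : X ⟶ X') (g : Y ⟶ Y') : tensor X Y ⟶ tensor X' Y' :=
  ⟨TensorProduct.map f.lin g.lin, fun h => by
    apply TensorProduct.ext'
    intro x y
    simp [HopfAction.tensor_apply, lin_apply]⟩

/-- The monoidal category `Rep(H)`. -/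
instance : MonoidalCategory (FinRep k H) where
  tensorObj := tensor
  tensorHom := tensorMap
  whiskerLeft X _ _ f := tensorMap (𝟙 X) f
  whiskerRight f Y := tensorMap f (𝟙 Y)
  tensorUnit := unit
  associator X Y Z := mkIso (TensorProduct.assoc k X.V Y.V Z.V) (HopfAction.tensor_assoc _ _ _)
  leftUnitor X := mkIso (TensorProduct.lid k X.V) (HopfAction.tensor_unit_left _)
  rightUnitor X := mkIso (TensorProduct.rid k X.V) (HopfAction.tensor_unit_right _)
  tensorHom_def f g := by
    apply hom_ext
    exact TensorProduct.ext' fun _ _ => rfl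
  id_tensorHom_id X Y := by
    apply hom_ext
    exact TensorProduct.ext' fun _ _ => rfl
  tensorHom_comp_tensorHom f g f' g' := by
    apply hom_ext
    exact TensorProduct.ext' fun _ _ => rfl
  whiskerLeft_id X Y := by
    apply hom_ext
    exact TensorProduct.ext' fun _ _ => rfl
  id_whiskerRight X Y := by
    apply hom_ext
    exact TensorProduct.ext' fun _ _ => rfl
  associator_naturality f g h := by
    apply hom_ext
    exact TensorProduct.ext_threefold fun _ _ _ => rfl
  leftUnitor_naturality f := by
    apply hom_ext
    exact TensorProduct.ext' fun c x => (f.lin.map_smul c x).symm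
  rightUnitor_naturality f := by
    apply hom_ext
    exact TensorProduct.ext' fun x c => (f.lin.map_smul c x).symm
  pentagon W X Y Z := by
    apply hom_ext
    exact TensorProduct.ext_fourfold fun _ _ _ _ => rfl
  triangle X Y := by
    apply hom_ext
    exact TensorProduct.ext_threefold fun x c y => (TensorProduct.smul_tmul c x y).symm

/-- The left dual `X^*` (in Mathlib's terminology the right dual `Xᘁ`): the dual space with the
action `(h f)(x) = f(S(h) x)`. -/
abbrev starDual (X : FinRep k H) : FinRep k H where
  V := Module.Dual k X.V
  ρ := HopfAction.dual X.ρ (antipode k) antipode_one antipode_mul_antidistrib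

variable (k H) in
/-- The inverse of the antipode of a finite-dimensional Hopf algebra. -/
def antipodeInv [FiniteDimensional k H] : H →ₗ[k] H :=
  (LinearEquiv.ofBijective (antipode k) (antipode_bijective k H)).symm.toLinearMap

@[simp] lemma antipode_antipodeInv [FiniteDimensional k H] (h : H) :
    antipode k (antipodeInv k H h) = h :=
  (LinearEquiv.ofBijective (antipode k) (antipode_bijective k H)).apply_symm_apply h

@[simp] lemma antipodeInv_antipode [FiniteDimensional k H] (h : H) :
    antipodeInv k H (antipode k h) = h :=
  (LinearEquiv.ofBijective (antipode k) (antipode_bijective k H)).symm_apply_apply h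

lemma antipodeInv_one [FiniteDimensional k H] : antipodeInv k H 1 = 1 :=
  (antipode_bijective k H).1 (by simp)

lemma antipodeInv_mul [FiniteDimensional k H] (a b : H) :
    antipodeInv k H (a * b) = antipodeInv k H b * antipodeInv k H a :=
  (antipode_bijective k H).1 (by simp [antipode_mul_antidistrib])

/-- The right dual `^*X` (in Mathlib's terminology the left dual `ᘁX`): the dual space with the
action `(h f)(x) = f(S⁻¹(h) x)`. -/
abbrev preDual [FiniteDimensional k H] (X : FinRep k H) : FinRep k H where
  V := Module.Dual k X.V
  ρ := HopfAction.dual X.ρ (antipodeInv k H) antipodeInv_one antipodeInv_mul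

end Monoidal
end FinRep
end

noncomputable section

open CategoryTheory MonoidalCategory Coalgebra HopfAlgebra Sweedler

/-- The canonical isomorphism `V ⊗ V^* ≃ End(V)`, `v ⊗ f ↦ (x ↦ f(x) v)`. -/
def tensorDualEquivEnd (k V : Type u) [Field k] [AddCommGroup V] [Module k V]
    [FiniteDimensional k V] : V ⊗[k] Module.Dual k V ≃ₗ[k] Module.End k V :=
  (TensorProduct.comm k V (Module.Dual k V)).trans (dualTensorHomEquiv k V V)

section

variable {k V : Type u} [Field k] [AddCommGroup V] [Module k V] [FiniteDimensional k V]

@[simp] lemma tensorDualEquivEnd_tmul (v : V) (f : Module.Dual k V) (x : V) :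
    tensorDualEquivEnd k V (v ⊗ₜ f) x = f x • v := by
  simp [tensorDualEquivEnd]

lemma tensorDualEquivEnd_coevaluation :
    tensorDualEquivEnd k V (coevaluation k V 1) = 1 := by
  ext x
  rw [coevaluation_apply_one]
  simpa [map_sum, LinearMap.sum_apply] using (Module.Basis.ofVectorSpace k V).sum_repr x

lemma tensorDualEquivEnd_map (a : Module.End k V) (b : Module.End k V)
    (t : V ⊗[k] Module.Dual k V) :
    tensorDualEquivEnd k V (TensorProduct.map a (Module.Dual.transpose b) t) =
      a * tensorDualEquivEnd k V t * b := by
  induction t with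
  | zero => simp
  | add x y hx hy => simp only [map_add, hx, hy, mul_add, add_mul]
  | tmul v f => ext x; simp; rfl

end

namespace HopfAction

variable {k H : Type u} [Field k] [Ring H] [HopfAlgebra k H]
  {V : Type u} [AddCommGroup V] [Module k V]

lemma dual_eq (ρ : H →ₐ[k] Module.End k V) (s : H →ₗ[k] H) (s_one : s 1 = 1)
    (s_mul : ∀ a b, s (a * b) = s b * s a) (h : H) :
    dual ρ s s_one s_mul h = Module.Dual.transpose (ρ (s h)) := rfl

lemma sum_action_eq (ρ : H →ₐ[k] Module.End k V) (h : H) (f g : H → H)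
    (hs : ∑ p ∈ sw k h, f p.1 * g p.2 = algebraMap k H (counit h)) :
    ∑ p ∈ sw k h, ρ (f p.1) * ρ (g p.2) = counit (R := k) h • (1 : Module.End k V) := by
  have := congrArg ρ hs
  simpa [map_sum, Algebra.algebraMap_eq_smul_one] using this

lemma sum_action_eq' (ρ : H →ₐ[k] Module.End k V) (h : H) (f g : H → H)
    (hs : ∑ p ∈ sw k h, f p.2 * g p.1 = algebraMap k H (counit h)) :
    ∑ p ∈ sw k h, ρ (f p.2) * ρ (g p.1) = counit (R := k) h • (1 : Module.End k V) := by
  have := congrArg ρ hs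
  simpa [map_sum, Algebra.algebraMap_eq_smul_one] using this

section

variable (ρ : H →ₐ[k] Module.End k V) (s : H →ₗ[k] H) (s_one : s 1 = 1)
  (s_mul : ∀ a b, s (a * b) = s b * s a) (h : H)

lemma evaluation_comm
    (hs : ∑ p ∈ sw k h, s p.1 * p.2 = algebraMap k H (counit h)) :
    contractLeft k V ∘ₗ tensor (dual ρ s s_one s_mul) ρ h = unit k H h ∘ₗ contractLeft k V := by
  apply TensorProduct.ext'
  intro f x
  have := congrArg (fun T => f (T x)) (sum_action_eq ρ h s id hs)
  simpa [tensor_apply, map_sum, unit_apply, LinearMap.sum_apply] using this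

lemma evaluation_comm'
    (hs : ∑ p ∈ sw k h, s p.2 * p.1 = algebraMap k H (counit h)) :
    (contractLeft k V ∘ₗ (TensorProduct.comm k V (Module.Dual k V)).toLinearMap) ∘ₗ
      tensor ρ (dual ρ s s_one s_mul) h =
      unit k H h ∘ₗ contractLeft k V ∘ₗ (TensorProduct.comm k V (Module.Dual k V)).toLinearMap := by
  apply TensorProduct.ext'
  intro x f
  have := congrArg (fun T => f (T x)) (sum_action_eq' ρ h s id hs)
  simpa [tensor_apply, map_sum, unit_apply, LinearMap.sum_apply] using this

variable [FiniteDimensional k V]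

lemma coevaluation_comm
    (hs : ∑ p ∈ sw k h, p.1 * s p.2 = algebraMap k H (counit h)) :
    coevaluation k V ∘ₗ unit k H h =
      tensor ρ (dual ρ s s_one s_mul) h ∘ₗ coevaluation k V := by
  apply LinearMap.ext_ring
  apply (tensorDualEquivEnd k V).injective
  have := sum_action_eq ρ h id s hs
  have h1 : unit k H h 1 = counit (R := k) h • (1 : k) := by simp [unit_apply]
  rw [LinearMap.comp_apply, LinearMap.comp_apply, h1, map_smul, map_smul,
    tensorDualEquivEnd_coevaluation, tensor_eq, LinearMap.sum_apply, map_sum]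
  simp only [dual_eq, tensorDualEquivEnd_map, tensorDualEquivEnd_coevaluation, mul_one]
  exact this.symm

lemma coevaluation_comm'
    (hs : ∑ p ∈ sw k h, p.2 * s p.1 = algebraMap k H (counit h)) :
    ((TensorProduct.comm k V (Module.Dual k V)).toLinearMap ∘ₗ coevaluation k V) ∘ₗ unit k H h =
      tensor (dual ρ s s_one s_mul) ρ h ∘ₗ
        (TensorProduct.comm k V (Module.Dual k V)).toLinearMap ∘ₗ coevaluation k V := by
  apply LinearMap.ext_ring
  apply ((TensorProduct.comm k V (Module.Dual k V)).symm.trans (tensorDualEquivEnd k V)).injective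
  have := sum_action_eq' ρ h id s hs
  have h1 : unit k H h 1 = counit (R := k) h • (1 : k) := by simp [unit_apply]
  have h2 : ∀ (a b : Module.End k V) (t : V ⊗[k] Module.Dual k V),
      (TensorProduct.comm k V (Module.Dual k V)).symm
        (TensorProduct.map (Module.Dual.transpose b) a (TensorProduct.comm k V _ t)) =
      TensorProduct.map a (Module.Dual.transpose b) t := by
    intro a b t
    induction t with
    | zero => simp
    | add x y hx hy => simp only [map_add, hx, hy]
    | tmul v f => simp
  rw [LinearMap.comp_apply, LinearMap.comp_apply, LinearMap.comp_apply, h1, map_smul, map_smul,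
    map_smul, tensor_eq, LinearMap.sum_apply, map_sum]
  simp only [LinearEquiv.trans_apply, LinearEquiv.coe_coe, LinearMap.comp_apply, dual_eq, h2,
    LinearEquiv.symm_apply_apply, tensorDualEquivEnd_map, tensorDualEquivEnd_coevaluation, mul_one]
  exact this.symm

end
end HopfAction

namespace FinRep

variable {k H : Type u} [Field k] [Ring H] [HopfAlgebra k H]

/-- The pairing of `X` with `X^*`: `ev(f ⊗ x) = f(x)` and `coev(1) = ∑ eᵢ ⊗ eⁱ`. -/
instance (X : FinRep k H) : ExactPairing X (starDual X) where
  coevaluation' := ⟨coevaluation k X.V, fun h =>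
    HopfAction.coevaluation_comm X.ρ _ antipode_one antipode_mul_antidistrib h (sw_mul_antipode h)⟩
  evaluation' := ⟨contractLeft k X.V, fun h =>
    HopfAction.evaluation_comm X.ρ _ antipode_one antipode_mul_antidistrib h (sw_antipode_mul h)⟩
  coevaluation_evaluation' := by
    apply hom_ext
    exact contractLeft_assoc_coevaluation k X.V
  evaluation_coevaluation' := by
    apply hom_ext
    exact contractLeft_assoc_coevaluation' k X.V

/-- `Rep(H)` has duals `X^*`. -/
instance : RightRigidCategory (FinRep k H) where
  rightDual X := { rightDual := starDual X }

lemma antipodeInv_identities [FiniteDimensional k H] (h : H) :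
    (∑ p ∈ sw k h, p.2 * antipodeInv k H p.1 = algebraMap k H (counit h)) ∧
      ∑ p ∈ sw k h, antipodeInv k H p.2 * p.1 = algebraMap k H (counit h) := by
  constructor <;> apply (antipode_bijective k H).1
  · simp [map_sum, antipode_mul_antidistrib, sw_mul_antipode, Algebra.algebraMap_eq_smul_one]
  · simp [map_sum, antipode_mul_antidistrib, sw_antipode_mul, Algebra.algebraMap_eq_smul_one]

/-- The pairing of `^*X` with `X`: `ev(x ⊗ f) = f(x)` and `coev(1) = ∑ eⁱ ⊗ eᵢ`. -/
instance [FiniteDimensional k H] (X : FinRep k H) : ExactPairing (preDual X) X where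
  coevaluation' := ⟨(TensorProduct.comm k X.V (Module.Dual k X.V)).toLinearMap ∘ₗ
    coevaluation k X.V, fun h =>
      HopfAction.coevaluation_comm' X.ρ _ antipodeInv_one antipodeInv_mul h (antipodeInv_identities h).1⟩
  evaluation' := ⟨contractLeft k X.V ∘ₗ
    (TensorProduct.comm k X.V (Module.Dual k X.V)).toLinearMap, fun h =>
      HopfAction.evaluation_comm' X.ρ _ antipodeInv_one antipodeInv_mul h (antipodeInv_identities h).2⟩
  coevaluation_evaluation' := by
    apply hom_ext
    apply TensorProduct.ext
    apply LinearMap.ext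
    intro x
    apply LinearMap.ext_ring
    change (LinearMap.rTensor X.V (contractLeft k X.V ∘ₗ
        (TensorProduct.comm k X.V (Module.Dual k X.V)).toLinearMap))
      ((TensorProduct.assoc k X.V (Module.Dual k X.V) X.V).symm
        (x ⊗ₜ (TensorProduct.comm k X.V (Module.Dual k X.V) (coevaluation k X.V 1)))) =
      (TensorProduct.lid k X.V).symm (TensorProduct.rid k X.V (x ⊗ₜ 1))
    apply (TensorProduct.lid k X.V).injective
    rw [coevaluation_apply_one]
    simpa [map_sum, TensorProduct.tmul_sum] using (Module.Basis.ofVectorSpace k X.V).sum_repr x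
  evaluation_coevaluation' := by
    apply hom_ext
    apply TensorProduct.ext
    apply LinearMap.ext_ring
    apply LinearMap.ext
    intro f
    change (LinearMap.lTensor (Module.Dual k X.V) (contractLeft k X.V ∘ₗ
        (TensorProduct.comm k X.V (Module.Dual k X.V)).toLinearMap))
      ((TensorProduct.assoc k (Module.Dual k X.V) X.V (Module.Dual k X.V))
        ((TensorProduct.comm k X.V (Module.Dual k X.V) (coevaluation k X.V 1)) ⊗ₜ f)) =
      (TensorProduct.rid k (Module.Dual k X.V)).symm
        (TensorProduct.lid k (Module.Dual k X.V) (1 ⊗ₜ f))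
    apply (TensorProduct.rid k (Module.Dual k X.V)).injective
    rw [coevaluation_apply_one]
    simpa [map_sum, TensorProduct.sum_tmul] using
      (Module.Basis.ofVectorSpace k X.V).sum_dual_apply_smul_coord f

/-- `Rep(H)` has duals `^*X` for a finite-dimensional Hopf algebra `H`. -/
instance [FiniteDimensional k H] : LeftRigidCategory (FinRep k H) where
  leftDual X := { leftDual := preDual X }

end FinRep
end

noncomputable section

open CategoryTheory MonoidalCategory Coalgebra HopfAlgebra Sweedler

namespace FinRep

variable {k H Q : Type u} [Field k] [Ring H] [HopfAlgebra k H] [Ring Q] [HopfAlgebra k Q]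

lemma tensor_comp (p : H →ₐc[k] Q) {V V' : Type u} [AddCommGroup V] [Module k V]
    [AddCommGroup V'] [Module k V'] (ρ : Q →ₐ[k] Module.End k V) (σ : Q →ₐ[k] Module.End k V')
    (h : H) : HopfAction.tensor (ρ.comp (p : H →ₐ[k] Q)) (σ.comp (p : H →ₐ[k] Q)) h =
      HopfAction.tensor ρ σ (p h) := by
  have h1 : (comul (p h) : Q ⊗[k] Q) = ∑ q ∈ sw k h, p q.1 ⊗ₜ[k] p q.2 := by
    rw [← CoalgHomClass.map_comp_comul_apply, sw_spec h]
    simp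
  rw [HopfAction.tensor_eq]
  simp only [HopfAction.tensor, AlgHom.comp_apply, Bialgebra.comulAlgHom_apply, h1, map_sum]
  rfl

/-- The restriction functor `Rep(Q) ⥤ Rep(H)` along a morphism of Hopf algebras `H → Q`. -/
def restrict (p : H →ₐc[k] Q) : FinRep k Q ⥤ FinRep k H where
  obj X := { V := X.V, ρ := X.ρ.comp (p : H →ₐ[k] Q) }
  map f := ⟨f.lin, fun h => f.comm (p h)⟩

/-- Restriction is a strict monoidal functor. -/
instance (p : H →ₐc[k] Q) : (restrict p).Monoidal :=
  Functor.CoreMonoidal.toMonoidal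
    { εIso := mkIso (LinearEquiv.refl k k) fun h => by
        apply LinearMap.ext_ring
        change HopfAction.unit k H h 1 = HopfAction.unit k Q (p h) 1
        simp [HopfAction.unit_apply]
      μIso := fun X Y => mkIso (LinearEquiv.refl k (X.V ⊗[k] Y.V)) fun h => by
        change HopfAction.tensor _ _ h = HopfAction.tensor _ _ (p h)
        exact tensor_comp p X.ρ Y.ρ h
      μIso_hom_natural_left := fun _ _ => rfl
      μIso_hom_natural_right := fun _ _ => rfl
      associativity := fun X Y Z => by
        apply hom_ext
        exact TensorProduct.ext_threefold fun _ _ _ => rfl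
      left_unitality := fun X => by
        apply hom_ext
        exact TensorProduct.ext' fun _ _ => rfl
      right_unitality := fun X => by
        apply hom_ext
        exact TensorProduct.ext' fun _ _ => rfl }

end FinRep
end

noncomputable section

open CategoryTheory MonoidalCategory Opposite MonoidalOpposite
open scoped MonoidalLeftAction MonoidalRightAction

namespace RelEnd

section Mates

variable {C : Type*} [Category C] [MonoidalCategory C]

/-- The dual `Y' ⟶ X'` of `f : X ⟶ Y`, with respect to given dual objects. -/
def mate {X X' Y Y' : C} (p : ExactPairing X X') (q : ExactPairing Y Y') (f : X ⟶ Y) : Y' ⟶ X' :=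
  @rightAdjointMate C _ _ X Y ⟨X'⟩ ⟨Y'⟩ f

lemma mate_spec {X X' Y Y' : C} (p : ExactPairing X X') (q : ExactPairing Y Y') (f : X ⟶ Y) :
    η_ Y Y' ≫ Y ◁ mate p q f = η_ X X' ≫ f ▷ X' :=
  @coevaluation_comp_rightAdjointMate C _ _ X Y ⟨X'⟩ ⟨Y'⟩ f

lemma eq_mate {X X' Y Y' : C} (p : ExactPairing X X') (q : ExactPairing Y Y') (f : X ⟶ Y)
    (g : Y' ⟶ X') (h : η_ Y Y' ≫ Y ◁ g = η_ X X' ≫ f ▷ X') : g = mate p q f := by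
  rw [← mate_spec p q f] at h
  have h2 : (ρ_ Y').hom ≫ g = (ρ_ Y').hom ≫ mate p q f := by
    apply (tensorLeftHomEquiv (𝟙_ C) Y Y' X').injective
    have h3 : ∀ u : Y' ⟶ X', tensorLeftHomEquiv (𝟙_ C) Y Y' X' ((ρ_ Y').hom ≫ u) =
        η_ Y Y' ≫ Y ◁ u := by
      intro u
      simp [tensorLeftHomEquiv, ← unitors_equal]
    rw [h3, h3, h]
  exact (cancel_epi _).1 h2

lemma mate_comp {X X' Y Y' Z Z' : C} (p : ExactPairing X X') (q : ExactPairing Y Y')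
    (r : ExactPairing Z Z') (f : X ⟶ Y) (g : Y ⟶ Z) :
    mate p r (f ≫ g) = mate q r g ≫ mate p q f :=
  @comp_rightAdjointMate C _ _ X Y Z ⟨X'⟩ ⟨Y'⟩ ⟨Z'⟩ f g

lemma mate_whiskerRight {X X' Y Y' E E' : C} (p : ExactPairing X X') (q : ExactPairing Y Y')
    (r : ExactPairing E E') (f : X ⟶ Y) :
    E' ◁ mate p q f = mate (ExactPairing.tensor (X₁ := X) (X₂ := E))
      (ExactPairing.tensor (X₁ := Y) (X₂ := E)) (f ▷ E) := by
  apply eq_mate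
  rw [ExactPairing.tensor_coevaluation, ExactPairing.tensor_coevaluation]
  calc
    _ = η_ Y Y' ⊗≫ ((Y ◁ η_ E E') ▷ Y' ≫ (Y ⊗ (E ⊗ E')) ◁ mate p q f) ⊗≫ 𝟙 _ := by monoidal
    _ = (η_ Y Y' ≫ Y ◁ mate p q f) ⊗≫ (Y ◁ η_ E E') ▷ X' ⊗≫ 𝟙 _ := by
      rw [← whisker_exchange]; monoidal
    _ = η_ X X' ⊗≫ (f ▷ 𝟙_ C ≫ Y ◁ η_ E E') ▷ X' ⊗≫ 𝟙 _ := by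
      rw [mate_spec]; monoidal
    _ = _ := by
      rw [← whisker_exchange]; monoidal

lemma mate_whiskerLeft {X X' E E' F F' : C} (p : ExactPairing X X') (q : ExactPairing E E')
    (r : ExactPairing F F') (f : E ⟶ F) :
    mate q r f ▷ X' = mate (ExactPairing.tensor (X₁ := X) (X₂ := E))
      (ExactPairing.tensor (X₁ := X) (X₂ := F)) (X ◁ f) := by
  apply eq_mate
  rw [ExactPairing.tensor_coevaluation, ExactPairing.tensor_coevaluation]
  calc
    _ = η_ X X' ⊗≫ (X ◁ (η_ F F' ≫ F ◁ mate q r f)) ▷ X' ⊗≫ 𝟙 _ := by monoidal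
    _ = _ := by
      rw [mate_spec]; monoidal

lemma rightDualIso_naturality {X X₁ X₂ Y Y₁ Y₂ : C} (p₁ : ExactPairing X X₁)
    (p₂ : ExactPairing X X₂) (q₁ : ExactPairing Y Y₁) (q₂ : ExactPairing Y Y₂) (f : X ⟶ Y) :
    mate p₁ q₁ f ≫ (rightDualIso p₁ p₂).hom = (rightDualIso q₁ q₂).hom ≫ mate p₂ q₂ f := by
  change mate p₁ q₁ f ≫ mate p₂ p₁ (𝟙 X) = mate q₂ q₁ (𝟙 Y) ≫ mate p₂ q₂ f
  rw [← mate_comp, ← mate_comp, Category.id_comp, Category.comp_id]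

end Mates

section RelativeEnd

variable {D : Type*} [Category D] [MonoidalCategory D] [RightRigidCategory D]
  {M : Type*} [Category M] [MonoidalLeftAction D M] {A : Type*} [Category A]

variable (D) in
/-- A prebalancing of a functor `S : Mᵒᵖ × M ⥤ A`, for an action of `D` on `M`: natural
isomorphisms `S(M, X ▹ N) ≅ S(X^* ▹ M, N)`. -/
structure Prebalancing (S : Mᵒᵖ ⥤ M ⥤ A) where
  /-- the isomorphisms -/
  iso (X : D) (m n : M) : (S.obj (op m)).obj (X ⊙ₗ n) ≅ (S.obj (op (Xᘁ ⊙ₗ m))).obj n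
  natural_left (X : D) {m m' : M} (f : m ⟶ m') (n : M) :
    (S.map f.op).app (X ⊙ₗ n) ≫ (iso X m n).hom =
      (iso X m' n).hom ≫ (S.map (Xᘁ ⊴ₗ f).op).app n
  natural_right (X : D) (m : M) {n n' : M} (g : n ⟶ n') :
    (S.obj (op m)).map (X ⊴ₗ g) ≫ (iso X m n').hom =
      (iso X m n).hom ≫ (S.obj (op (Xᘁ ⊙ₗ m))).map g
  natural_action {X Y : D} (f : X ⟶ Y) (m n : M) :
    (S.obj (op m)).map (f ⊵ₗ n) ≫ (iso Y m n).hom =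
      (iso X m n).hom ≫ (S.map (rightAdjointMate f ⊵ₗ m).op).app n

/-- Dinatural transformations `π : E ⟶ S(m, m)` which satisfy
`S(ev_X ▹ id, id) ∘ π_m = S(α, id) ∘ β ∘ π_{X ▹ m}` for all `X`, `m`, where `ev_X : X^* ⊗ X ⟶ 1` and
`α : (X^* ⊗ X) ▹ m ⟶ X^* ▹ (X ▹ m)`. -/
structure IsRelativeWedge (S : Mᵒᵖ ⥤ M ⥤ A) (β : Prebalancing D S) (E : A)
    (π : ∀ m : M, E ⟶ (S.obj (op m)).obj m) : Prop where
  dinatural {m n : M} (f : m ⟶ n) :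
    π m ≫ (S.obj (op m)).map f = π n ≫ (S.map f.op).app n
  balanced (X : D) (m : M) :
    π m ≫ (S.map ((ε_ X Xᘁ ⊵ₗ m) ≫ (λₗ m).hom).op).app m =
      π (X ⊙ₗ m) ≫ (β.iso X (X ⊙ₗ m) m).hom ≫ (S.map (αₗ Xᘁ X m).hom.op).app m

/-- `E` with `π` is the relative end of `(S, β)`: a universal wedge of the above kind. -/
structure IsRelativeEnd (S : Mᵒᵖ ⥤ M ⥤ A) (β : Prebalancing D S) (E : A)
    (π : ∀ m : M, E ⟶ (S.obj (op m)).obj m) : Prop where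
  wedge : IsRelativeWedge S β E π
  universal (E' : A) (π' : ∀ m : M, E' ⟶ (S.obj (op m)).obj m) :
    IsRelativeWedge S β E' π' → ∃! h : E' ⟶ E, ∀ m, h ≫ π m = π' m

end RelativeEnd

section Subcategory

variable {C : Type*} [Category C] [MonoidalCategory C]

/-- The dual of an object of the reversed category `D^rev` is its dual on the other side
in `D`. -/
instance {D : Type*} [Category D] [MonoidalCategory D] [LeftRigidCategory D] :
    RightRigidCategory Dᴹᵒᵖ where
  rightDual X :=
    { rightDual := mop (ᘁ(unmop X) : D)
      exact :=
        { coevaluation' := (η_ (ᘁ(unmop X) : D) (unmop X)).mop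
          evaluation' := (ε_ (ᘁ(unmop X) : D) (unmop X)).mop
          coevaluation_evaluation' :=
            congrArg Quiver.Hom.mop (ExactPairing.evaluation_coevaluation (ᘁ(unmop X) : D) (unmop X))
          evaluation_coevaluation' :=
            congrArg Quiver.Hom.mop
              (ExactPairing.coevaluation_evaluation (ᘁ(unmop X) : D) (unmop X)) } }

variable {D : Type*} [Category D] [MonoidalCategory D] (ι : D ⥤ C) [ι.Monoidal]

/-- The right action `X · d = X ⊗ ι(d)` of `D` on `C`. -/
abbrev rightAction : MonoidalRightAction D C where
  actionObj X d := X ⊗ ι.obj d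
  actionHomLeft f d := f ▷ ι.obj d
  actionHomRight X _ _ g := X ◁ ι.map g
  actionHom f g := f ⊗ₘ ι.map g
  actionAssocIso X d d' := whiskerLeftIso X (Functor.Monoidal.μIso ι d d').symm ≪≫
    (α_ X (ι.obj d) (ι.obj d')).symm
  actionUnitIso X := whiskerLeftIso X (Functor.Monoidal.εIso ι).symm ≪≫ ρ_ X
  actionHom_def f g := by simp [MonoidalCategory.tensorHom_def]
  actionAssocIso_hom_naturality {X₁ X₂ d₁ d₂ d₃ d₄} f g h := by
    have h1 : (f ⊗ₘ ι.map (g ⊗ₘ h)) ≫ X₂ ◁ Functor.OplaxMonoidal.δ ι d₂ d₄ =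
        X₁ ◁ Functor.OplaxMonoidal.δ ι d₁ d₃ ≫ (f ⊗ₘ (ι.map g ⊗ₘ ι.map h)) := by
      rw [← id_tensorHom, ← id_tensorHom, tensorHom_comp_tensorHom, tensorHom_comp_tensorHom,
        Functor.OplaxMonoidal.δ_natural, Category.id_comp, Category.comp_id]
    simpa using h1 =≫ (α_ X₂ (ι.obj d₂) (ι.obj d₄)).inv
  actionUnitIso_hom_naturality {X Y} f := by
    have h1 := whisker_exchange f (Functor.OplaxMonoidal.η ι)
    simpa using h1 =≫ (ρ_ Y).hom
  actionHomRight_whiskerRight {d d'} f c X := by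
    simp [← MonoidalCategory.whiskerLeft_comp]
  whiskerRight_actionHomLeft c {d d'} f X := by
    simp [← MonoidalCategory.whiskerLeft_comp]
  actionHom_associator c₁ c₂ c₃ X := by
    have h1 := Functor.OplaxMonoidal.associativity ι c₁ c₂ c₃
    have h2 := congrArg (fun t => X ◁ t) h1
    simp only [MonoidalCategory.whiskerLeft_comp] at h2
    have h3 := h2 =≫ ((α_ X (ι.obj c₁) (ι.obj c₂ ⊗ ι.obj c₃)).inv ≫
      (α_ (X ⊗ ι.obj c₁) (ι.obj c₂) (ι.obj c₃)).inv)
    simp at h3 ⊢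
    exact h3.symm
  actionHom_leftUnitor c X := by
    simp [← MonoidalCategory.whiskerLeft_comp]
  actionHom_rightUnitor c X := by
    have h := congrArg (fun t => X ◁ t) (Functor.OplaxMonoidal.right_unitality_hom ι c)
    simp only [MonoidalCategory.whiskerLeft_comp] at h
    simp
    rw [MonoidalCategory.rightUnitor_tensor_hom, Iso.inv_hom_id_assoc]
    exact h.symm

/-- The left action `d ▹ X = X ⊗ ι(d)` of `D^rev` on `C`. -/
abbrev revAction : MonoidalLeftAction Dᴹᵒᵖ C :=
  letI := rightAction ι
  MonoidalLeftAction.monoidalOppositeLeftAction D C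

/-- The image of a dual pair under a monoidal functor. -/
abbrev mapPairing (X Y : D) [ExactPairing X Y] : ExactPairing (ι.obj X) (ι.obj Y) where
  coevaluation' := Functor.LaxMonoidal.ε ι ≫ ι.map (η_ X Y) ≫ Functor.OplaxMonoidal.δ ι X Y
  evaluation' := Functor.LaxMonoidal.μ ι Y X ≫ ι.map (ε_ X Y) ≫ Functor.OplaxMonoidal.η ι
  coevaluation_evaluation' := by
    have h := Functor.LaxMonoidal.associativity_inv ι Y X Y
    have h1 : ι.obj Y ◁ Functor.OplaxMonoidal.δ ι X Y ≫ (α_ _ _ _).inv ≫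
        Functor.LaxMonoidal.μ ι Y X ▷ ι.obj Y = Functor.LaxMonoidal.μ ι Y (X ⊗ Y) ≫
          ι.map (α_ Y X Y).inv ≫ Functor.OplaxMonoidal.δ ι (Y ⊗ X) Y := by
      rw [← cancel_mono (Functor.LaxMonoidal.μ ι (Y ⊗ X) Y)]
      simp only [Category.assoc, Functor.Monoidal.δ_μ, Category.comp_id]
      rw [← cancel_epi (ι.obj Y ◁ Functor.LaxMonoidal.μ ι X Y), h,
        ← MonoidalCategory.whiskerLeft_comp_assoc]
      simp
    have h2 := congrArg ι.map (ExactPairing.coevaluation_evaluation X Y)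
    simp only [Functor.map_comp] at h2
    rw [Functor.LaxMonoidal.right_unitality, Functor.OplaxMonoidal.left_unitality]
    simp only [MonoidalCategory.whiskerLeft_comp, comp_whiskerRight, Category.assoc]
    rw [reassoc_of% h1, Functor.LaxMonoidal.μ_natural_right_assoc,
      Functor.OplaxMonoidal.δ_natural_left_assoc, reassoc_of% h2]
  evaluation_coevaluation' := by
    have h := Functor.LaxMonoidal.associativity ι X Y X
    have h1 : Functor.OplaxMonoidal.δ ι X Y ▷ ι.obj X ≫ (α_ _ _ _).hom ≫
        ι.obj X ◁ Functor.LaxMonoidal.μ ι Y X = Functor.LaxMonoidal.μ ι (X ⊗ Y) X ≫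
          ι.map (α_ X Y X).hom ≫ Functor.OplaxMonoidal.δ ι X (Y ⊗ X) := by
      rw [← cancel_mono (Functor.LaxMonoidal.μ ι X (Y ⊗ X))]
      simp only [Category.assoc, Functor.Monoidal.δ_μ, Category.comp_id]
      rw [← cancel_epi (Functor.LaxMonoidal.μ ι X Y ▷ ι.obj X), h,
        ← comp_whiskerRight_assoc]
      simp
    have h2 := congrArg ι.map (ExactPairing.evaluation_coevaluation X Y)
    simp only [Functor.map_comp] at h2
    rw [Functor.LaxMonoidal.left_unitality, Functor.OplaxMonoidal.right_unitality]
    simp only [MonoidalCategory.whiskerLeft_comp, comp_whiskerRight, Category.assoc]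
    rw [reassoc_of% h1, Functor.LaxMonoidal.μ_natural_left_assoc,
      Functor.OplaxMonoidal.δ_natural_right_assoc, reassoc_of% h2]

lemma map_mate [LeftRigidCategory D] {X Y : D} (f : X ⟶ Y) :
    ι.map f = mate (mapPairing ι (ᘁY : D) Y) (mapPairing ι (ᘁX : D) X)
      (ι.map (leftAdjointMate f)) := by
  let := mapPairing ι (ᘁX : D) X
  let := mapPairing ι (ᘁY : D) Y
  apply eq_mate
  have h := congrArg ι.map (coevaluation_comp_leftAdjointMate f)
  change (Functor.LaxMonoidal.ε ι ≫ ι.map (η_ (ᘁX : D) X) ≫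
      Functor.OplaxMonoidal.δ ι _ _) ≫ _ ◁ ι.map f =
    (Functor.LaxMonoidal.ε ι ≫ ι.map (η_ (ᘁY : D) Y) ≫
      Functor.OplaxMonoidal.δ ι _ _) ≫ ι.map (leftAdjointMate f) ▷ _
  simp only [Category.assoc, Functor.OplaxMonoidal.δ_natural_left,
    Functor.OplaxMonoidal.δ_natural_right]
  simp only [Functor.map_comp] at h
  rw [reassoc_of% h]

variable [RightRigidCategory C]

variable (C) in
/-- The functor `S(X, Y) = Y ⊗ X^*`, the internal Hom of the regular module category `C`. -/
@[simps]
def internalHom : Cᵒᵖ ⥤ C ⥤ C where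
  obj X := tensorRight (unop X)ᘁ
  map f := { app := fun Y => Y ◁ rightAdjointMate f.unop, naturality := fun _ _ g => by simp [whisker_exchange] }
  map_id X := by ext; simp
  map_comp f g := by ext; simp [comp_rightAdjointMate]

variable [LeftRigidCategory D]

/-- The pairing of `M ⊗ ι(^*X)` with `ι(X) ⊗ M^*`. -/
abbrev tensorPairing (M : C) (X : D) : ExactPairing (M ⊗ ι.obj (ᘁX : D)) (ι.obj X ⊗ Mᘁ) :=
  letI := mapPairing ι (ᘁX : D) X
  ExactPairing.tensor

/-- The canonical isomorphism `ι(X) ⊗ M^* ≅ (M ⊗ ι(^*X))^*`. -/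
def dualIso (M : C) (X : D) : ι.obj X ⊗ Mᘁ ≅ (M ⊗ ι.obj (ᘁX : D))ᘁ :=
  rightDualIso (tensorPairing ι M X) HasRightDual.exact

lemma dualIso_natural_left {M M' : C} (f : M ⟶ M') (X : D) :
    (ι.obj X ◁ rightAdjointMate f) ≫ (dualIso ι M X).hom =
      (dualIso ι M' X).hom ≫ rightAdjointMate (f ▷ ι.obj (ᘁX : D)) := by
  let := mapPairing ι (ᘁX : D) X
  have h := rightDualIso_naturality (tensorPairing ι M X) HasRightDual.exact
    (tensorPairing ι M' X) HasRightDual.exact (f ▷ ι.obj (ᘁX : D))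
  rw [← mate_whiskerRight HasRightDual.exact HasRightDual.exact] at h
  exact h

lemma dualIso_natural_right (M : C) {X Y : D} (f : X ⟶ Y) :
    ι.map f ▷ Mᘁ ≫ (dualIso ι M Y).hom =
      (dualIso ι M X).hom ≫ rightAdjointMate (M ◁ ι.map (leftAdjointMate f)) := by
  have h := rightDualIso_naturality (tensorPairing ι M Y) HasRightDual.exact
    (tensorPairing ι M X) HasRightDual.exact (M ◁ ι.map (leftAdjointMate f))
  rw [← mate_whiskerLeft HasRightDual.exact (mapPairing ι (ᘁY : D) Y) (mapPairing ι (ᘁX : D) X),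
    ← map_mate] at h
  exact h

/-- The `D^rev`-prebalancing of `S(X, Y) = Y ⊗ X^*`, which is the composition
`(N ⊗ X) ⊗ M^* ≅ N ⊗ (X ⊗ M^*) ≅ N ⊗ (M ⊗ ^*X)^*`. -/
def prebalancing : letI := revAction ι
    Prebalancing Dᴹᵒᵖ (internalHom C) :=
  letI := revAction ι
  { iso := fun X M N =>
      α_ N (ι.obj (unmop X)) Mᘁ ≪≫ whiskerLeftIso N (dualIso ι M (unmop X))
    natural_left := fun X {M M'} f N => by
      have h := dualIso_natural_left ι f (unmop X)
      have h1 : ∀ (Z : C) (g : M'ᘁ ⟶ Z), (N ⊗ ι.obj (unmop X)) ◁ g ≫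
          (α_ N (ι.obj (unmop X)) Z).hom = (α_ N (ι.obj (unmop X)) _).hom ≫
            N ◁ (ι.obj (unmop X) ◁ g) := fun Z g => by simp
      change (N ⊗ ι.obj (unmop X)) ◁ rightAdjointMate f ≫
        (α_ N (ι.obj (unmop X)) Mᘁ).hom ≫ N ◁ (dualIso ι M (unmop X)).hom =
        ((α_ N (ι.obj (unmop X)) M'ᘁ).hom ≫ N ◁ (dualIso ι M' (unmop X)).hom) ≫
          N ◁ rightAdjointMate (f ▷ ι.obj (ᘁ(unmop X) : D))
      rw [reassoc_of% h1, ← MonoidalCategory.whiskerLeft_comp, h]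
      simp
    natural_right := fun X M {N N'} g => by
      change (g ▷ ι.obj (unmop X)) ▷ Mᘁ ≫
        (α_ N' (ι.obj (unmop X)) Mᘁ).hom ≫ N' ◁ (dualIso ι M (unmop X)).hom =
        ((α_ N (ι.obj (unmop X)) Mᘁ).hom ≫ N ◁ (dualIso ι M (unmop X)).hom) ≫ g ▷ _
      simp [whisker_exchange]
    natural_action := fun {X Y} f M N => by
      have h := dualIso_natural_right ι M f.unmop
      change (N ◁ ι.map f.unmop) ▷ Mᘁ ≫
        (α_ N (ι.obj (unmop Y)) Mᘁ).hom ≫ N ◁ (dualIso ι M (unmop Y)).hom =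
        ((α_ N (ι.obj (unmop X)) Mᘁ).hom ≫ N ◁ (dualIso ι M (unmop X)).hom) ≫
          N ◁ rightAdjointMate (M ◁ ι.map (leftAdjointMate f.unmop))
      rw [Category.assoc, ← MonoidalCategory.whiskerLeft_comp, ← h]
      simp }

end Subcategory
end RelEnd
end

noncomputable section

open CategoryTheory MonoidalCategory Opposite MonoidalOpposite

namespace RelEnd

variable {C : Type*} [Category C] [MonoidalCategory C] [RightRigidCategory C]

/-- The morphism `𝔟 : (N ⊗ (X ⊗ M)^*) ⊗ X ⟶ N ⊗ M^*`, obtained from the canonical isomorphism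
`N ⊗ (X ⊗ M)^* ≅ (N ⊗ M^*) ⊗ X^*` and the evaluation of `X`. -/
def evalHom (X M N : C) : (N ⊗ (X ⊗ M)ᘁ) ⊗ X ⟶ N ⊗ Mᘁ :=
  (N ◁ (rightDualTensorIso X M).hom ≫ (α_ N Mᘁ Xᘁ).inv) ▷ X ≫
    (α_ (N ⊗ Mᘁ) Xᘁ X).hom ≫ (N ⊗ Mᘁ) ◁ ε_ X Xᘁ ≫ (ρ_ (N ⊗ Mᘁ)).hom

/-- The composition `(M ⊗ M^*) ⊗ (M ⊗ M^*) ⟶ M ⊗ M^*` of internal endomorphisms. -/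
def compHom (M : C) : (M ⊗ Mᘁ) ⊗ (M ⊗ Mᘁ) ⟶ M ⊗ Mᘁ :=
  (α_ M Mᘁ (M ⊗ Mᘁ)).hom ≫ M ◁ ((α_ Mᘁ M Mᘁ).inv ≫ ε_ M Mᘁ ▷ Mᘁ ≫ (λ_ Mᘁ).hom)

/-- `A`, an algebra in the Drinfeld center of `C`, together with dinatural transformations
`π_M : A ⟶ M ⊗ M^*`, is the relative adjoint algebra of `ι : D ⥤ C`: the object `A` is the relative
end of `S(X, Y) = Y ⊗ X^*` over the `D^rev`-module category `C`, its half-braiding `σ` is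
determined by `(id ⊗ π_M) σ_X = 𝔞 𝔟 (π_{X ⊗ M} ⊗ id)`, where `𝔞` is the associativity
`(X ⊗ M) ⊗ M^* ≅ X ⊗ (M ⊗ M^*)`, its product by `π_M m = comp_M (π_M ⊗ π_M)`, and its unit
by `π_M u = coev_M`. -/
structure IsRelativeAdjointAlgebra {D : Type*} [Category D] [MonoidalCategory D]
    [LeftRigidCategory D] (ι : D ⥤ C) [ι.Monoidal] (A : Center C) [MonObj A]
    (π : ∀ M : C, A.1 ⟶ M ⊗ Mᘁ) : Prop where
  isRelativeEnd : letI := revAction ι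
    IsRelativeEnd (internalHom C) (prebalancing ι) A.1 π
  halfBraiding (X M : C) :
    (A.2.β X).hom ≫ X ◁ π M = π (X ⊗ M) ▷ X ≫ evalHom X M (X ⊗ M) ≫ (α_ X M Mᘁ).hom
  mul (M : C) : (MonObj.mul (X := A)).f ≫ π M = (π M ⊗ₘ π M) ≫ compHom M
  one (M : C) : (MonObj.one (X := A)).f ≫ π M = η_ M Mᘁ

end RelEnd

section Coinvariants

open Coalgebra HopfAlgebra Sweedler

variable {k H Q : Type u} [Field k] [Ring H] [HopfAlgebra k H] [Ring Q] [HopfAlgebra k Q]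

/-- The coinvariants `{h | h₁ ⊗ p(h₂) = h ⊗ 1}` of a morphism of Hopf algebras `p : H → Q`. -/
def coinvariants (p : H →ₐc[k] Q) : Subalgebra k H :=
  AlgHom.equalizer
    ((Algebra.TensorProduct.map (AlgHom.id k H) (p : H →ₐ[k] Q)).comp (Bialgebra.comulAlgHom k H))
    Algebra.TensorProduct.includeLeft

lemma mem_coinvariants (p : H →ₐc[k] Q) (h : H) :
    h ∈ coinvariants p ↔
      (p : H →ₐ[k] Q).toLinearMap.lTensor H (comul (R := k) h) = h ⊗ₜ[k] (1 : Q) := Iff.rfl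

/-- The adjoint action `h ▹ x = h₁ x S(h₂)`. -/
def adjointAction (h x : H) : H :=
  LinearMap.mul' k H (TensorProduct.map (LinearMap.mulRight k x) (antipode k) (comul (R := k) h))

end Coinvariants
end

open CategoryTheory MonoidalCategory

noncomputable section

open Coalgebra HopfAlgebra Sweedler MonoidalOpposite Opposite

/-! Under `M ⊗ M^* ≅ End(M)`, a family `π_M : E ⟶ M ⊗ M^*` assigns to every `e` in `E` an
endomorphism of every module `M`. Dinaturality says that these endomorphisms commute with all module
maps. Testing against the maps `H → M`, `1 ↦ m`, shows that the endomorphism of `M` is the action of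
the single element `g(e) = π_H(e)(1)` of `H` (`wedge_apply`). Since `H` acts on `End(M)` by `T ↦ h₁
T S(h₂)`, the map `g` intertwines the action on `E` with the adjoint action.

The balancing condition for a `Q`-module `X` says that the endomorphism of `M ⊗ X` is that of `M`
tensored with the identity of `X` (`balanced_iff`). For the action of `a` this reads `a₁ m ⊗ p(a₂) x
= a m ⊗ x`. Evaluated at `1 ⊗ 1` in `H ⊗ Q` it becomes the coinvariance of `a`, and conversely
coinvariance gives it for all `M` and `X`. Hence the coinvariants with the action maps are the
relative end (`coinvariantHom_isRelativeEnd`).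

For existence, the coinvariants must also carry the central algebra structure. They are stable under
the adjoint action, being an equalizer of two module maps. The map `a ⊗ x ↦ a₁ x ⊗ a₂` lands in `X ⊗
H^{co p}`, by coassociativity and exactness of tensoring over a field (`comul_mem_range`). It is
bijective, because `S⁻¹` gives injectivity and dimensions agree. Equivariance of braiding, product
and unit is inherited from an embedding into a module where they become categorical morphisms.

For an arbitrary relative adjoint algebra, the universal property gives an isomorphism with the
coinvariants that turns `π_M` into the action. The formulas for product, unit and half-braiding then
determine these on the coinvariants, since `H` acts faithfully on itself. -/

lemma exactPairing_tensor_evaluation {C : Type*} [Category C] [MonoidalCategory C]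
    (X Y X' Y' : C) [ExactPairing X X'] [ExactPairing Y Y'] :
    ε_ (X ⊗ Y) (Y' ⊗ X') = (α_ Y' X' (X ⊗ Y)).hom ≫
      Y' ◁ ((α_ X' X Y).inv ≫ ε_ X X' ▷ Y ≫ (λ_ Y).hom) ≫ ε_ Y Y' := by
  rw [ExactPairing.tensor_evaluation]
  monoidal

/-! ### Linear maps as tensors with a dual space -/

section

variable (k : Type u) [Field k] (V W : Type u) [AddCommGroup V] [Module k V]
  [FiniteDimensional k V] [AddCommGroup W] [Module k W]

/-- The canonical isomorphism `W ⊗ V^* ≃ Hom(V, W)`. -/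
def tensorDualEquivHom : W ⊗[k] Module.Dual k V ≃ₗ[k] (V →ₗ[k] W) :=
  (TensorProduct.comm k W (Module.Dual k V)).trans (dualTensorHomEquiv k V W)

variable {k V W}

@[simp] lemma tensorDualEquivHom_tmul (w : W) (f : Module.Dual k V) (x : V) :
    tensorDualEquivHom k V W (w ⊗ₜ f) x = f x • w := by
  simp [tensorDualEquivHom]

lemma tensorDualEquivHom_self : tensorDualEquivHom k V V = tensorDualEquivEnd k V := rfl

/-- Contracting the second factor with the coordinate functionals of a finite basis of `V` recovers
all coefficients of a tensor. -/
lemma tensor_ext_of_dual {s t : W ⊗[k] V}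
    (h : ∀ φ : Module.Dual k V, TensorProduct.rid k W (LinearMap.lTensor W φ s) =
      TensorProduct.rid k W (LinearMap.lTensor W φ t)) : s = t := by
  have key : ∀ r : W ⊗[k] V, r = ∑ i, TensorProduct.rid k W
      (LinearMap.lTensor W ((Module.finBasis k V).coord i) r) ⊗ₜ Module.finBasis k V i := by
    intro r
    induction r with
    | zero => simp
    | add x y hx hy =>
      simp only [map_add, TensorProduct.add_tmul, Finset.sum_add_distrib]
      rw [← hx, ← hy]
    | tmul w v =>
      conv_lhs => rw [← (Module.finBasis k V).sum_repr v, TensorProduct.tmul_sum]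
      simp [TensorProduct.smul_tmul']
  rw [key s, key t]
  simp only [h]

variable {V' W' : Type u} [AddCommGroup V'] [Module k V'] [FiniteDimensional k V']
  [AddCommGroup W'] [Module k W']

/-- Naturality in both variables: it turns the functor `S(M, N) = N ⊗ M^*` into pre- and
postcomposition of linear maps. -/
lemma tensorDualEquivHom_map (g : W →ₗ[k] W') (f : V' →ₗ[k] V) (t : W ⊗[k] Module.Dual k V) :
    tensorDualEquivHom k V' W' (TensorProduct.map g (Module.Dual.transpose f) t) =
      g ∘ₗ tensorDualEquivHom k V W t ∘ₗ f := by
  induction t with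
  | zero => simp
  | add x y hx hy => simp only [map_add, hx, hy, LinearMap.add_comp, LinearMap.comp_add]
  | tmul w φ => ext x; simp; rfl

end

/-! ### The categorical structure maps of `Rep(H)` as operations on linear maps -/

namespace FinRep

variable {k H : Type u} [Field k] [Ring H] [HopfAlgebra k H]

/-- A mate is compatible with the evaluations. Here evaluation is `g ⊗ x ↦ g(x)`, so this
compatibility is the definition of the transpose. -/
lemma rightAdjointMate_lin {X Y : FinRep k H} (f : X ⟶ Y) :
    (rightAdjointMate f).lin = Module.Dual.transpose f.lin := by
  have h := congrArg Hom.lin (rightAdjointMate_comp_evaluation f)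
  apply LinearMap.ext; intro g
  apply LinearMap.ext; intro x
  exact LinearMap.congr_fun h (g ⊗ₜ x)

/-- The comparison of two duals is the mate of the identity. This makes it computable when the
target dual is a space of functionals: the image of `y` is the functional that pairs with `x` as `y`
does. -/
lemma rightDualIso_lin {X Y Y' : FinRep k H} (p : ExactPairing X Y) (q : ExactPairing X Y')
    (y : Y.V) (x : X.V) :
    (ε_ X Y').lin ((rightDualIso p q).hom.lin y ⊗ₜ[k] x) = (ε_ X Y).lin (y ⊗ₜ[k] x) := by
  have h := congrArg Hom.lin
    (@rightAdjointMate_comp_evaluation (FinRep k H) _ _ X X ⟨Y'⟩ ⟨Y⟩ (𝟙 X))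
  exact LinearMap.congr_fun h (y ⊗ₜ x)

lemma rightDualTensorIso_inv_lin (X Y : FinRep k H) (f : Module.Dual k Y.V)
    (g : Module.Dual k X.V) :
    (rightDualTensorIso X Y).inv.lin (f ⊗ₜ[k] g) =
      TensorProduct.dualDistrib k X.V Y.V (g ⊗ₜ f) := by
  apply TensorProduct.ext'
  intro x y
  refine (rightDualIso_lin (X := X ⊗ Y) (Y := Yᘁ ⊗ Xᘁ) (Y' := (X ⊗ Y)ᘁ)
     ExactPairing.tensor HasRightDual.exact (f ⊗ₜ g) (x ⊗ₜ y)).trans ?_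
  -- In this bracketing the inner pair is contracted before the outer one, so the value on pure
  -- tensors is found by unfolding.
  rw [exactPairing_tensor_evaluation]
  change f (g x • y) = g x * f y
  simp

lemma rightDualTensorIso_hom_lin (X Y : FinRep k H) (f : Module.Dual k Y.V)
    (g : Module.Dual k X.V) :
    (rightDualTensorIso X Y).hom.lin (TensorProduct.dualDistrib k X.V Y.V (g ⊗ₜ f)) =
      f ⊗ₜ[k] g := by
  rw [← rightDualTensorIso_inv_lin]
  exact LinearMap.congr_fun (congrArg Hom.lin (rightDualTensorIso X Y).inv_hom_id) _

/-- In terms of linear maps, `evalHom` inserts `x` into the first argument of a map `X ⊗ M → N`. -/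
lemma evalHom_lin (X M N : FinRep k H) (t : (N ⊗ (X ⊗ M)ᘁ : FinRep k H).V) (x : X.V) (m : M.V) :
    tensorDualEquivHom k M.V N.V ((RelEnd.evalHom X M N).lin (t ⊗ₜ x)) m =
      tensorDualEquivHom k (X.V ⊗[k] M.V) N.V t (x ⊗ₜ m) := by
  -- By finite dimensionality every functional on `X ⊗ M` is a sum of products `g ⊗ f`, on which the
  -- canonical isomorphism is explicit.
  obtain ⟨s, rfl⟩ : ∃ s : N.V ⊗[k] (Module.Dual k X.V ⊗[k] Module.Dual k M.V),
      LinearMap.lTensor N.V (TensorProduct.dualDistrib k X.V M.V) s = t :=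
    (LinearMap.lTensor_surjective N.V
      (TensorProduct.dualDistribEquiv k X.V M.V).surjective) t
  induction s using TensorProduct.induction_on with
  | zero => simp
  | add a b ha hb =>
    simp only [map_add, TensorProduct.add_tmul, LinearMap.add_apply] at ha hb ⊢
    rw [ha, hb]
  | tmul n s =>
  induction s using TensorProduct.induction_on with
  | zero => simp
  | add a b ha hb =>
    simp only [map_add, TensorProduct.tmul_add, TensorProduct.add_tmul,
      LinearMap.add_apply] at ha hb ⊢
    rw [ha, hb]
  | tmul g f =>
    have h := rightDualTensorIso_hom_lin X M f g
    have h1 : (RelEnd.evalHom X M N).lin ((n ⊗ₜ[k]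
        (TensorProduct.dualDistrib k X.V M.V (g ⊗ₜ f))) ⊗ₜ[k] x) = g x • (n ⊗ₜ[k] f) := by
      refine (congrArg (fun z => ((ρ_ (N ⊗ Mᘁ)).hom.lin (((N ⊗ Mᘁ) ◁ ε_ X Xᘁ).lin
        ((α_ (N ⊗ Mᘁ) Xᘁ X).hom.lin ((α_ N Mᘁ Xᘁ).inv.lin (n ⊗ₜ[k] z) ⊗ₜ[k] x)))))
          h).trans ?_
      rfl
    refine (congrArg (fun z => tensorDualEquivHom k M.V N.V z m) h1).trans ?_
    simp [smul_smul]

lemma compHom_lin (M : FinRep k H) (s t : M.V ⊗[k] Module.Dual k M.V) :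
    tensorDualEquivEnd k M.V ((RelEnd.compHom M).lin (s ⊗ₜ t)) =
      tensorDualEquivEnd k M.V s * tensorDualEquivEnd k M.V t := by
  induction s using TensorProduct.induction_on with
  | zero => simp
  | add a b ha hb =>
    simp only [map_add, TensorProduct.add_tmul, add_mul] at ha hb ⊢
    rw [ha, hb]
  | tmul n f =>
  induction t using TensorProduct.induction_on with
  | zero => simp
  | add a b ha hb =>
    simp only [map_add, TensorProduct.tmul_add, mul_add] at ha hb ⊢
    rw [ha, hb]
  | tmul m g =>
    ext x
    change tensorDualEquivEnd k M.V (n ⊗ₜ (f m • g)) x = _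
    simp [smul_smul, mul_comm]

lemma whiskerLeft_lin (X : FinRep k H) {Y Z : FinRep k H} (f : Y ⟶ Z) :
    (X ◁ f).lin = LinearMap.lTensor X.V f.lin := rfl

variable {Q : Type u} [Ring Q] [HopfAlgebra k Q] [FiniteDimensional k Q]

/-- A vector of `X` becomes a functional on `^*X` by evaluation. The image of the pairing under
restriction is still the plain contraction, because the monoidal constraints of restriction are
identities on vectors. -/
lemma dualIso_lin (p : H →ₐc[k] Q) (M : FinRep k H) (X : FinRep k Q) (x : X.V)
    (f : Module.Dual k M.V) :
    (RelEnd.dualIso (restrict p) M X).hom.lin (x ⊗ₜ[k] f) =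
      TensorProduct.dualDistrib k M.V (Module.Dual k X.V) (f ⊗ₜ Module.Dual.eval k X.V x) := by
  let := RelEnd.mapPairing (restrict p) (ᘁX : FinRep k Q) X
  apply TensorProduct.ext'
  intro m (g : Module.Dual k X.V)
  refine (rightDualIso_lin (RelEnd.tensorPairing (restrict p) M X) HasRightDual.exact
    (x ⊗ₜ f) (m ⊗ₜ g)).trans ?_
  have := exactPairing_tensor_evaluation M (((restrict p).obj (ᘁX : FinRep k Q))) Mᘁ ((restrict p).obj X)
  refine (LinearMap.congr_fun (congrArg Hom.lin this) _).trans ?_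
  change (f m • g) x = f m * g x
  rfl

/-- The prebalancing moves `X` from the target to the source: `T : M → N ⊗ X` becomes `m ⊗ g ↦ (id ⊗
g)(T m)`. The map `L` is known only through its values on pure tensors, which keeps the induction
free of module structures. -/
lemma tensorDualEquivHom_rotate {N X M : Type u} [AddCommGroup N] [Module k N] [AddCommGroup X]
    [Module k X] [FiniteDimensional k X] [AddCommGroup M] [Module k M] [FiniteDimensional k M]
    (L : (N ⊗[k] X) ⊗[k] Module.Dual k M →ₗ[k] N ⊗[k] Module.Dual k (M ⊗[k] Module.Dual k X))
    (hL : ∀ n x f, L ((n ⊗ₜ x) ⊗ₜ f) =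
      n ⊗ₜ TensorProduct.dualDistrib k M (Module.Dual k X) (f ⊗ₜ Module.Dual.eval k X x))
    (t : (N ⊗[k] X) ⊗[k] Module.Dual k M) (m : M) (g : Module.Dual k X) :
    tensorDualEquivHom k (M ⊗[k] Module.Dual k X) N (L t) (m ⊗ₜ g) =
      TensorProduct.rid k N (LinearMap.lTensor N g (tensorDualEquivHom k M (N ⊗[k] X) t m)) := by
  induction t using TensorProduct.induction_on with
  | zero => simp
  | add a b ha hb => simp only [map_add, LinearMap.add_apply, ha, hb]
  | tmul s f =>
  induction s using TensorProduct.induction_on with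
  | zero => simp
  | add a b ha hb => simp only [map_add, TensorProduct.add_tmul, LinearMap.add_apply, ha, hb]
  | tmul n x => simp [hL, smul_smul]

lemma prebalancing_lin (p : H →ₐc[k] Q) (M N : FinRep k H) (X : FinRep k Q)
    (t : (N.V ⊗[k] X.V) ⊗[k] Module.Dual k M.V) (m : M.V) (g : Module.Dual k X.V) :
    letI := RelEnd.revAction (restrict p)
    tensorDualEquivHom k (M.V ⊗[k] Module.Dual k X.V) N.V
        ((((RelEnd.prebalancing (restrict p)).iso (mop X) M N).hom.lin) t) (m ⊗ₜ g) =
      TensorProduct.rid k N.V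
        (LinearMap.lTensor N.V g (tensorDualEquivHom k M.V (N.V ⊗[k] X.V) t m)) :=
  tensorDualEquivHom_rotate _ (fun n x f => congrArg (fun z => n ⊗ₜ[k] z) (dualIso_lin p M X x f))
    t m g

lemma internalHom_map_lin {M M' : FinRep k H} (φ : M' ⟶ M) (N : FinRep k H)
    (t : N.V ⊗[k] Module.Dual k M.V) :
    tensorDualEquivHom k M'.V N.V
        ((((RelEnd.internalHom (FinRep k H)).map φ.op).app N).lin t) =
      tensorDualEquivHom k M.V N.V t ∘ₗ φ.lin := by
  have h := tensorDualEquivHom_map LinearMap.id φ.lin t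
  rw [← rightAdjointMate_lin] at h
  exact h

/-- The left-hand side of the balancing condition for `E ⟶ M ⊗ M^*`. -/
def balancingLeft (p : H →ₐc[k] Q) {E : FinRep k H} (X : FinRep k Q) (M : FinRep k H)
    (f : E ⟶ M ⊗ Mᘁ) : E ⟶ M ⊗ (M ⊗ (restrict p).obj (X ⊗ ᘁX))ᘁ :=
  letI := RelEnd.revAction (restrict p)
  f ≫ ((RelEnd.internalHom (FinRep k H)).map
    (MonoidalLeftAction.actionHomLeft (ε_ (mop X) (mop X)ᘁ) M ≫
      (MonoidalLeftAction.actionUnitIso M).hom).op).app M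

/-- The right-hand side of the balancing condition for `E ⟶ (M ⊗ X) ⊗ (M ⊗ X)^*`. -/
def balancingRight (p : H →ₐc[k] Q) {E : FinRep k H} (X : FinRep k Q) (M : FinRep k H)
    (g : E ⟶ (M ⊗ (restrict p).obj X) ⊗ (M ⊗ (restrict p).obj X)ᘁ) :
    E ⟶ M ⊗ (M ⊗ (restrict p).obj (X ⊗ ᘁX))ᘁ :=
  letI := RelEnd.revAction (restrict p)
  g ≫ ((RelEnd.prebalancing (restrict p)).iso (mop X)
      (MonoidalLeftAction.actionObj (mop X) M) M).hom ≫
    ((RelEnd.internalHom (FinRep k H)).map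
      (MonoidalLeftAction.actionAssocIso (mop X)ᘁ (mop X) M).hom.op).app M

/-- The balancing condition at an element says that the endomorphism of `M ⊗ X` is that of `M`,
tensored with the identity of `X`. -/
lemma balanced_iff (p : H →ₐc[k] Q) {E : FinRep k H} (X : FinRep k Q) (M : FinRep k H)
    (f : E ⟶ M ⊗ Mᘁ)
    (g : E ⟶ (M ⊗ (restrict p).obj X) ⊗ (M ⊗ (restrict p).obj X)ᘁ) (e : E.V) :
    (balancingLeft p X M f).lin e = (balancingRight p X M g).lin e ↔
      tensorDualEquivEnd k (M.V ⊗[k] X.V) (g.lin e) =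
        LinearMap.rTensor X.V (tensorDualEquivEnd k M.V (f.lin e)) := by
  let := RelEnd.revAction (restrict p)
  -- The evaluation in the reversed category is that of `^*X` with `X`, so it acts as the
  -- contraction `m ⊗ x ⊗ f ↦ f(x) m`.
  have h1 : (MonoidalLeftAction.actionHomLeft (ε_ (mop X) (mop X)ᘁ) M ≫
          (MonoidalLeftAction.actionUnitIso M).hom).lin =
      (TensorProduct.rid k M.V).toLinearMap ∘ₗ LinearMap.lTensor M.V (contractLeft k X.V ∘ₗ
        (TensorProduct.comm k X.V (Module.Dual k X.V)).toLinearMap) := by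
    apply TensorProduct.ext
    apply LinearMap.ext
    intro m
    exact TensorProduct.ext' fun x f => rfl
  have h2 : (MonoidalLeftAction.actionAssocIso (mop X)ᘁ (mop X) M).hom.lin =
      (TensorProduct.assoc k M.V X.V (Module.Dual k X.V)).symm.toLinearMap := by
    apply TensorProduct.ext
    apply LinearMap.ext
    intro m
    exact TensorProduct.ext' fun x f => rfl
  have h3 := internalHom_map_lin (MonoidalLeftAction.actionHomLeft (ε_ (mop X) (mop X)ᘁ) M ≫
    (MonoidalLeftAction.actionUnitIso M).hom) M (f.lin e)
  have h4 := internalHom_map_lin (MonoidalLeftAction.actionAssocIso (mop X)ᘁ (mop X) M).hom M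
    (((RelEnd.prebalancing (restrict p)).iso (mop X)
          (MonoidalLeftAction.actionObj (mop X) M) M).hom.lin (g.lin e))
  -- Both sides are compared as linear maps `M ⊗ (X ⊗ X^*) → M`.
  refine Iff.trans (tensorDualEquivHom k (M.V ⊗[k] (X.V ⊗[k] Module.Dual k X.V))
    M.V).injective.eq_iff.symm ?_
  refine Iff.trans (Iff.of_eq (congrArg₂ Eq (h3.trans (congrArg (fun z => _ ∘ₗ z) h1))
    (h4.trans (congrArg (fun z => _ ∘ₗ z) h2)))) ?_
  rw [← tensorDualEquivHom_self, ← tensorDualEquivHom_self]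
  have h5 := prebalancing_lin p (M ⊗ (restrict p).obj X) M X (g.lin e)
  constructor
  · intro h
    apply TensorProduct.ext'
    intro m x
    -- At `m ⊗ x ⊗ φ` the two sides are `φ(x) T(m)` and `(id ⊗ φ)(U(m ⊗ x))`, where `T` and `U` are
    -- the endomorphisms of `M` and `M ⊗ X`. Letting `φ` vary gives `U(m ⊗ x) = T(m) ⊗ x`.
    apply tensor_ext_of_dual
    intro φ
    have h6 := LinearMap.congr_fun h (m ⊗ₜ (x ⊗ₜ φ))
    refine ((h5 (m ⊗ₜ x) φ).symm.trans h6.symm).trans ?_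
    refine Eq.trans (LinearMap.map_smul (tensorDualEquivHom k M.V M.V (f.lin e)) (φ x) m) ?_
    simp
  · intro h
    apply TensorProduct.ext
    apply LinearMap.ext
    intro m
    apply TensorProduct.ext'
    intro (x : X.V) (φ : Module.Dual k X.V)
    refine Eq.trans ?_ (h5 (m ⊗ₜ x) φ).symm
    refine Eq.trans ?_ (congrArg (fun z => TensorProduct.rid k M.V (LinearMap.lTensor M.V φ z))
      (LinearMap.congr_fun h (m ⊗ₜ x))).symm
    refine Eq.trans (LinearMap.map_smul (tensorDualEquivHom k M.V M.V (f.lin e)) (φ x) m) ?_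
    simp

/-- Removes the reversed category from the wedge conditions, leaving equations of morphisms in
`Rep(H)` indexed by `Q`-modules. -/
lemma isRelativeWedge_iff (p : H →ₐc[k] Q) (E : FinRep k H) (π : ∀ M : FinRep k H, E ⟶ M ⊗ Mᘁ) :
    letI := RelEnd.revAction (restrict p)
    RelEnd.IsRelativeWedge (RelEnd.internalHom (FinRep k H)) (RelEnd.prebalancing (restrict p)) E π ↔
      (∀ {M N : FinRep k H} (f : M ⟶ N),
        π M ≫ ((RelEnd.internalHom (FinRep k H)).obj (op M)).map f =
          π N ≫ ((RelEnd.internalHom (FinRep k H)).map f.op).app N) ∧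
      ∀ (X : FinRep k Q) (M : FinRep k H), balancingLeft p X M (π M) =
        balancingRight p X M (π (M ⊗ (restrict p).obj X)) :=
  letI := RelEnd.revAction (restrict p)
  ⟨fun h => ⟨h.dinatural, fun X M => h.balanced (mop X) M⟩,
    fun h => ⟨h.1, fun X M => h.2 (unmop X) M⟩⟩

/-- For fixed `e`, dinaturality makes the endomorphisms a natural endomorphism of the forgetful
functor to vector spaces. -/
lemma dinatural_iff {E M N : FinRep k H} (f : M ⟶ N) (a : E ⟶ M ⊗ Mᘁ) (b : E ⟶ N ⊗ Nᘁ) (e : E.V) :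
    (a ≫ ((RelEnd.internalHom (FinRep k H)).obj (op M)).map f).lin e =
      (b ≫ ((RelEnd.internalHom (FinRep k H)).map f.op).app N).lin e ↔
    f.lin ∘ₗ tensorDualEquivEnd k M.V (a.lin e) = tensorDualEquivEnd k N.V (b.lin e) ∘ₗ f.lin := by
  have h1 := tensorDualEquivHom_map f.lin LinearMap.id (a.lin e)
  have h2 := tensorDualEquivHom_map LinearMap.id f.lin (b.lin e)
  rw [LinearMap.comp_id] at h1
  rw [LinearMap.id_comp] at h2
  rw [← tensorDualEquivHom_self, ← tensorDualEquivHom_self, ← h1, ← h2,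
    (tensorDualEquivHom k M.V N.V).injective.eq_iff, ← rightAdjointMate_lin]
  have h3 : Module.Dual.transpose (LinearMap.id : M.V →ₗ[k] M.V) = LinearMap.id := rfl
  rw [h3]
  rfl

end FinRep

/-! ### The adjoint action, the coinvariants and the relative end -/

namespace FinRep

variable {k H : Type u} [Field k] [Ring H]

variable (k H) in
/-- The regular module. -/
abbrev regular [Algebra k H] [FiniteDimensional k H] : FinRep k H where
  V := H
  ρ := Algebra.lmul k H

variable [HopfAlgebra k H]

lemma adjointAction_eq (h x : H) :
    adjointAction (k := k) h x = ∑ p ∈ sw k h, p.1 * x * antipode k p.2 := by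
  simp [adjointAction, sw_spec h]

lemma action_adjointAction (M : FinRep k H) (h a : H) :
    M.ρ (adjointAction (k := k) h a) =
      ∑ p ∈ sw k h, M.ρ p.1 * M.ρ a * M.ρ (antipode k p.2) := by
  simp [adjointAction_eq]

lemma tensorDualEquivEnd_action (M : FinRep k H) (h : H) (t : M.V ⊗[k] Module.Dual k M.V) :
    tensorDualEquivEnd k M.V ((M ⊗ Mᘁ : FinRep k H).ρ h t) =
      ∑ p ∈ sw k h, M.ρ p.1 * tensorDualEquivEnd k M.V t * M.ρ (antipode k p.2) := by
  have h1 : (M ⊗ Mᘁ : FinRep k H).ρ h t = ∑ p ∈ sw k h,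
      TensorProduct.map (M.ρ p.1) (Module.Dual.transpose (M.ρ (antipode k p.2))) t := by
    change HopfAction.tensor _ _ h t = _
    rw [HopfAction.tensor_eq, LinearMap.sum_apply]
    rfl
  rw [h1, map_sum]
  simp only [tensorDualEquivEnd_map]

/-- The map `H → M ⊗ M^* ≅ End(M)` given by the action. -/
def actionTensor (M : FinRep k H) : H →ₗ[k] M.V ⊗[k] Module.Dual k M.V :=
  (tensorDualEquivEnd k M.V).symm.toLinearMap ∘ₗ M.ρ.toLinearMap

@[simp] lemma tensorDualEquivEnd_actionTensor (M : FinRep k H) (a : H) :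
    tensorDualEquivEnd k M.V (actionTensor M a) = M.ρ a := by
  simp [actionTensor]

/-- The action of `h` on `End(M)` is `T ↦ h₁ T S(h₂)`, and the representation is multiplicative. So
the adjoint action is exactly what makes `H → End(M)` equivariant. -/
lemma actionTensor_adjointAction (M : FinRep k H) (h a : H) :
    actionTensor M (adjointAction (k := k) h a) = (M ⊗ Mᘁ : FinRep k H).ρ h (actionTensor M a) := by
  apply (tensorDualEquivEnd k M.V).injective
  rw [tensorDualEquivEnd_actionTensor, action_adjointAction]
  refine Eq.trans ?_ (tensorDualEquivEnd_action M h _).symm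
  simp

variable {Q : Type u} [Ring Q] [HopfAlgebra k Q]

/-- The action of `a` depends only on `a₁ ⊗ p(a₂)`, the element that coinvariance replaces by `a ⊗
1`. -/
lemma tensor_restrict_action (p : H →ₐc[k] Q) (M : FinRep k H) (X : FinRep k Q) (a : H) :
    (M ⊗ (restrict p).obj X : FinRep k H).ρ a =
      Module.endTensorEndAlgHom (R := k) (S := k) (A := k) (Algebra.TensorProduct.map M.ρ X.ρ
        ((p : H →ₐ[k] Q).toLinearMap.lTensor H (comul (R := k) a))) := by
  change HopfAction.tensor _ _ a = _
  rw [HopfAction.tensor_eq, sw_spec (k := k) a]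
  simp
  rfl

lemma action_of_mem_coinvariants (p : H →ₐc[k] Q) {a : H} (ha : a ∈ coinvariants p)
    (M : FinRep k H) (X : FinRep k Q) :
    (M ⊗ (restrict p).obj X : FinRep k H).ρ a = LinearMap.rTensor X.V (M.ρ a) := by
  rw [tensor_restrict_action, (mem_coinvariants p a).1 ha]
  simp
  rfl

/-- The equalizer of two module maps is a submodule. This gives the stability of the coinvariants
under the adjoint action. -/
lemma lin_eq_action {E Z : FinRep k H} (l r : E ⟶ Z) (h : H) (x : E.V) (hx : l.lin x = r.lin x) :
    l.lin (E.ρ h x) = r.lin (E.ρ h x) := by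
  rw [lin_apply, lin_apply, hx]

variable [FiniteDimensional k H]

/-- Faithfulness of the regular module: later identities in `H` are checked on its endomorphisms. -/
lemma regular_injective : Function.Injective (regular k H).ρ := fun a b h => by
  simpa using LinearMap.congr_fun h (1 : H)

lemma actionTensor_regular_injective : Function.Injective (actionTensor (regular k H)) :=
  (tensorDualEquivEnd k _).symm.injective.comp regular_injective

variable (k H) in
/-- `H` with the adjoint action. -/
def adjoint : FinRep k H where
  V := H
  ρ := AlgHom.ofLinearMap
    (LinearMap.mk₂ k (fun h x => adjointAction (k := k) h x)
      (by intros; simp [adjointAction])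
      (by intros; simp [adjointAction])
      (by intros; simp [adjointAction_eq, mul_add, add_mul, Finset.sum_add_distrib])
      (by intros; simp [adjointAction_eq, Finset.smul_sum]))
    (by
      apply LinearMap.ext
      intro x
      change adjointAction 1 x = x
      simp [adjointAction, Algebra.TensorProduct.one_def])
    (fun a b => by
      apply LinearMap.ext
      intro x
      -- The module axiom is inherited from `H ⊗ H^*` along an injective map that intertwines the
      -- two actions.
      apply actionTensor_regular_injective (k := k) (H := H)
      change actionTensor _ (adjointAction (a * b) x) =
        actionTensor _ (adjointAction a (adjointAction b x))
      rw [actionTensor_adjointAction, actionTensor_adjointAction, actionTensor_adjointAction,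
        map_mul]
      rfl)

/-- The equivariant map `H → M ⊗ M^*` given by the action. -/
def adjointHom (M : FinRep k H) : adjoint k H ⟶ M ⊗ Mᘁ :=
  ⟨actionTensor M, fun h => LinearMap.ext fun a => actionTensor_adjointAction M h a⟩

variable [FiniteDimensional k Q]

/-- A single pair of test modules detects coinvariance: on `H ⊗ Q` the action of `a` sends `1 ⊗ 1`
to `a₁ ⊗ p(a₂)`. -/
lemma mem_coinvariants_iff (p : H →ₐc[k] Q) (a : H) :
    a ∈ coinvariants p ↔ (regular k H ⊗ (restrict p).obj (regular k Q) : FinRep k H).ρ a =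
      LinearMap.rTensor Q ((regular k H).ρ a) := by
  refine ⟨fun ha => action_of_mem_coinvariants p ha _ _, fun h => ?_⟩
  rw [mem_coinvariants]
  have h1 : (regular k H ⊗ (restrict p).obj (regular k Q) : FinRep k H).ρ a
      ((1 : H) ⊗ₜ[k] (1 : Q)) = (a * 1) ⊗ₜ[k] (1 : Q) := LinearMap.congr_fun h _
  have h2 : HopfAction.tensor (Algebra.lmul k H) ((Algebra.lmul k Q).comp (p : H →ₐ[k] Q)) a
      ((1 : H) ⊗ₜ[k] (1 : Q)) = (p : H →ₐ[k] Q).toLinearMap.lTensor H (comul (R := k) a) := by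
    rw [HopfAction.tensor_apply, sw_spec (k := k) a]
    simp
  exact (h2.symm.trans h1).trans (by rw [mul_one])

/-- Presents the coinvariants as the equalizer of two morphisms out of the adjoint module. -/
lemma mem_coinvariants_iff_balancing (p : H →ₐc[k] Q) (x : (adjoint k H).V) :
    (x : H) ∈ coinvariants p ↔
      (balancingLeft p (regular k Q) (regular k H) (adjointHom _)).lin x =
        (balancingRight p (regular k Q) (regular k H) (adjointHom _)).lin x := by
  rw [balanced_iff]
  refine (mem_coinvariants_iff p x).trans (Iff.of_eq (congrArg₂ Eq ?_ ?_))
  · exact (tensorDualEquivEnd_actionTensor (regular k H ⊗ (restrict p).obj (regular k Q)) x).symm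
  · exact congrArg (LinearMap.rTensor Q) (tensorDualEquivEnd_actionTensor (regular k H) x).symm

lemma adjointAction_mem_coinvariants (p : H →ₐc[k] Q) (h : H) {a : H} (ha : a ∈ coinvariants p) :
    adjointAction (k := k) h a ∈ coinvariants p := by
  have h1 := (mem_coinvariants_iff_balancing p a).1 ha
  have h2 := lin_eq_action _ _ h _ h1
  exact (mem_coinvariants_iff_balancing p ((adjoint k H).ρ h a)).2 h2

/-- The coinvariants with the adjoint action. -/
abbrev coinvariantRep (p : H →ₐc[k] Q) : FinRep k H where
  V := coinvariants p
  ρ := AlgHom.ofLinearMap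
    (LinearMap.mk₂ k (fun h x => (⟨adjointAction (k := k) h (x : H),
        adjointAction_mem_coinvariants p h x.2⟩ : coinvariants p))
      (fun a b x => Subtype.ext (LinearMap.congr_fun (map_add (adjoint k H).ρ a b) (x : H)))
      (fun c a x => Subtype.ext (LinearMap.congr_fun (map_smul (adjoint k H).ρ c a) (x : H)))
      (fun a x y => Subtype.ext (map_add ((adjoint k H).ρ a) (x : H) (y : H)))
      (fun c a x => Subtype.ext (map_smul ((adjoint k H).ρ a) c (x : H))))
    (LinearMap.ext fun x =>
      Subtype.ext (LinearMap.congr_fun (map_one (adjoint k H).ρ) (x : H)))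
    (fun a b => LinearMap.ext fun x =>
      Subtype.ext (LinearMap.congr_fun (map_mul (adjoint k H).ρ a b) (x : H)))

/-- The inclusion of the coinvariants. -/
def coinvariantIncl (p : H →ₐc[k] Q) : coinvariantRep p ⟶ adjoint k H :=
  ⟨(coinvariants p).val.toLinearMap, fun _ => rfl⟩

/-- The maps `a ↦ (m ↦ a m)` from the coinvariants to `M ⊗ M^*`. -/
def coinvariantHom (p : H →ₐc[k] Q) (M : FinRep k H) : coinvariantRep p ⟶ M ⊗ Mᘁ :=
  coinvariantIncl p ≫ adjointHom M

lemma tensorDualEquivEnd_coinvariantHom (p : H →ₐc[k] Q) (M : FinRep k H) (a : coinvariants p) :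
    tensorDualEquivEnd k M.V ((coinvariantHom p M).lin a) = M.ρ (a : H) :=
  tensorDualEquivEnd_actionTensor M (a : H)

/-- The module map `H → M` determined by an element of `M`. -/
def ofElement (M : FinRep k H) (m : M.V) : regular k H ⟶ M :=
  ⟨M.ρ.toLinearMap.flip m, fun h => by
    apply LinearMap.ext
    intro x
    exact LinearMap.congr_fun (map_mul M.ρ h x) m⟩

/-- A Yoneda argument: commutation with the module map `H → M`, `1 ↦ m`, computes the endomorphism
of `M` at `m` from that of `H` at `1`. -/
lemma wedge_apply {E : FinRep k H} {π : ∀ M : FinRep k H, E ⟶ M ⊗ Mᘁ}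
    (h : ∀ {M N : FinRep k H} (f : M ⟶ N),
      π M ≫ ((RelEnd.internalHom (FinRep k H)).obj (op M)).map f =
        π N ≫ ((RelEnd.internalHom (FinRep k H)).map f.op).app N) (M : FinRep k H) (e : E.V) :
    tensorDualEquivEnd k M.V ((π M).lin e) =
      M.ρ (tensorDualEquivEnd k H ((π (regular k H)).lin e) 1) := by
  apply LinearMap.ext
  intro m
  have h1 := (dinatural_iff (ofElement M m) _ _ e).1
    (LinearMap.congr_fun (congrArg Hom.lin (h (ofElement M m))) e)
  have h2 := LinearMap.congr_fun h1 (1 : H)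
  refine Eq.trans ?_ h2.symm
  change _ = tensorDualEquivEnd k M.V ((π M).lin e) (M.ρ 1 m)
  simp

theorem coinvariantHom_isRelativeEnd (p : H →ₐc[k] Q) :
    letI := RelEnd.revAction (restrict p)
    RelEnd.IsRelativeEnd (RelEnd.internalHom (FinRep k H)) (RelEnd.prebalancing (restrict p))
      (coinvariantRep p) (coinvariantHom p) := by
  let := RelEnd.revAction (restrict p)
  refine ⟨(isRelativeWedge_iff p _ _).2 ⟨?_, ?_⟩, ?_⟩
  · intro M N f
    apply hom_ext
    apply LinearMap.ext
    intro a
    refine (dinatural_iff f (coinvariantHom p M) (coinvariantHom p N) a).2 ?_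
    refine Eq.trans (congrArg (fun z => f.lin ∘ₗ z) (tensorDualEquivEnd_coinvariantHom p M a)) ?_
    refine Eq.trans ?_
      (congrArg (fun z => z ∘ₗ f.lin) (tensorDualEquivEnd_coinvariantHom p N a)).symm
    exact f.comm _
  · intro X M
    apply hom_ext
    apply LinearMap.ext
    intro a
    refine (balanced_iff p X M (coinvariantHom p M)
      (coinvariantHom p (M ⊗ (restrict p).obj X)) a).2 ?_
    refine (tensorDualEquivEnd_coinvariantHom p (M ⊗ (restrict p).obj X) a).trans ?_
    refine Eq.trans ?_ (congrArg (LinearMap.rTensor X.V)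
      (tensorDualEquivEnd_coinvariantHom p M a)).symm
    exact action_of_mem_coinvariants p a.2 M X
  · intro E π hπ
    obtain ⟨hπ, hπ'⟩ := (isRelativeWedge_iff p E π).1 hπ
    have h1 := wedge_apply hπ
    -- The factorization through `H`: `g(e)` is the image of `1` under the endomorphism of the
    -- regular module.
    let g : E.V →ₗ[k] H := LinearMap.applyₗ (1 : H) ∘ₗ
      (tensorDualEquivEnd k H).toLinearMap ∘ₗ (π (regular k H)).lin
    have h2 : ∀ M e, tensorDualEquivEnd k M.V ((π M).lin e) = M.ρ (g e) := h1
    have h3 : ∀ e, g e ∈ coinvariants p := by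
      intro e
      rw [mem_coinvariants_iff]
      have h4 := (balanced_iff p (regular k Q) (regular k H) _ (π (regular k H ⊗ (restrict p).obj (regular k Q))) e).1
        (LinearMap.congr_fun (congrArg Hom.lin (hπ' (regular k Q) (regular k H))) e)
      refine (h2 (regular k H ⊗ (restrict p).obj (regular k Q)) e).symm.trans (h4.trans ?_)
      exact congrArg (LinearMap.rTensor Q) (h2 (regular k H) e)
    -- Equivariance of `g` follows from that of `π_H`, by comparing the actions of both sides on
    -- `H`.
    have h4 : ∀ h e, g (E.ρ h e) = adjointAction (k := k) h (g e) := by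
      intro h e
      apply regular_injective (k := k) (H := H)
      rw [← h2, action_adjointAction, lin_apply]
      refine (tensorDualEquivEnd_action _ h _).trans ?_
      exact Finset.sum_congr rfl fun q _ => congrArg (fun z : Module.End k H =>
        (regular k H).ρ q.1 * z * (regular k H).ρ (antipode k q.2)) (h2 (regular k H) e)
    refine ⟨⟨g.codRestrict (coinvariants p).toSubmodule h3, fun h => ?_⟩, fun M => ?_, ?_⟩
    · apply LinearMap.ext; intro e; apply Subtype.ext
      exact h4 h e
    · apply hom_ext
      apply LinearMap.ext; intro e
      apply (tensorDualEquivEnd k M.V).injective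
      exact (tensorDualEquivEnd_coinvariantHom p M _).trans (h2 M e).symm
    -- The component at the regular module alone determines `f`, by faithfulness.
    · intro f hf
      apply hom_ext
      apply LinearMap.ext; intro e
      apply Subtype.ext
      apply regular_injective (k := k) (H := H)
      refine (tensorDualEquivEnd_coinvariantHom p _ _).symm.trans ?_
      refine Eq.trans ?_ (h2 _ e)
      exact congrArg (fun z => tensorDualEquivEnd k H (Hom.lin z e)) (hf (regular k H))

end FinRep

/-! ### The half-braiding of the coinvariants -/

namespace FinRep

variable {k H : Type u} [Field k] [Ring H] [HopfAlgebra k H]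

/-- The map `h ⊗ x ↦ h₁ x ⊗ h₂`. -/
def braidLin (X : FinRep k H) : H ⊗[k] X.V →ₗ[k] X.V ⊗[k] H :=
  TensorProduct.lift (LinearMap.mk₂ k
    (fun h x => LinearMap.rTensor H (X.ρ.toLinearMap.flip x) (comul (R := k) h))
    (by intros; simp) (by intros; simp)
    (by intros; simp [LinearMap.rTensor_add]) (by intros; simp [LinearMap.rTensor_smul]))

lemma braidLin_tmul (X : FinRep k H) (h : H) (x : X.V) : braidLin X (h ⊗ₜ x) =
    LinearMap.rTensor H (X.ρ.toLinearMap.flip x) (comul (R := k) h) := rfl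

lemma braidLin_eq_sum (X : FinRep k H) (h : H) (x : X.V) : braidLin X (h ⊗ₜ x) =
    ∑ q ∈ sw k h, X.ρ q.1 x ⊗ₜ[k] q.2 := by
  rw [braidLin_tmul, sw_spec (k := k) h, map_sum]
  rfl

/-- A left inverse is `x ⊗ h ↦ h₂ ⊗ S⁻¹(h₁) x`, since `h₃ ⊗ S⁻¹(h₂) h₁ x = h ⊗ x`. -/
lemma braidLin_injective [FiniteDimensional k H] (X : FinRep k H) :
    Function.Injective (braidLin X) := by
  let F (x : X.V) : H →ₗ[k] H ⊗[k] X.V :=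
    LinearMap.lTensor H (X.ρ.toLinearMap.flip x ∘ₗ antipodeInv k H) ∘ₗ
      (TensorProduct.comm k H H).toLinearMap ∘ₗ comul
  have hF : ∀ x h, F x h = ∑ q ∈ sw k h, q.2 ⊗ₜ[k] X.ρ (antipodeInv k H q.1) x := by
    intro x h
    simp [F, sw_spec (k := k) h]
  let G : X.V ⊗[k] H →ₗ[k] H ⊗[k] X.V := TensorProduct.lift (LinearMap.mk₂ k (fun x h => F x h)
    (by intros; simp [hF, TensorProduct.tmul_add, Finset.sum_add_distrib])
    (by intros; simp [hF, Finset.smul_sum]) (by intros; simp) (by intros; simp))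
  have hG : G ∘ₗ braidLin X = LinearMap.id := by
    apply TensorProduct.ext'
    intro h x
    have h1 : G (braidLin X (h ⊗ₜ x)) = ∑ r ∈ sw k h, ∑ q ∈ sw k r.2,
        q.2 ⊗ₜ[k] X.ρ (antipodeInv k H q.1 * r.1) x := by
      rw [braidLin_eq_sum, map_sum]
      refine Finset.sum_congr rfl fun r _ => ?_
      refine (hF _ _).trans (Finset.sum_congr rfl fun q _ => ?_)
      simp
    change G (braidLin X (h ⊗ₜ x)) = _
    -- Regrouping puts `S⁻¹(h₂) h₁` into one inner sum, which collapses to the counit.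
    rw [h1, ← coassoc' (fun a b c => c ⊗ₜ[k] X.ρ (antipodeInv k H b * a) x)]
    · have h2 : ∀ r : H × H, ∑ q ∈ sw k r.1, r.2 ⊗ₜ[k] X.ρ (antipodeInv k H q.2 * q.1) x =
          counit (R := k) r.1 • (r.2 ⊗ₜ[k] x) := by
        intro r
        rw [← TensorProduct.tmul_sum, ← LinearMap.sum_apply, ← map_sum,
          (antipodeInv_identities r.1).2]
        simp [Algebra.algebraMap_eq_smul_one]
      simp_rw [h2]
      exact counit_left (k := k) ((TensorProduct.mk k H X.V).flip x) h
    all_goals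
      intros
      constructor <;> intros <;>
        simp [add_mul, mul_add, TensorProduct.tmul_add, TensorProduct.add_tmul,
          TensorProduct.smul_tmul']
  exact Function.LeftInverse.injective (g := G) fun t => LinearMap.congr_fun hG t

/-- Evaluation of the map `X ⊗ (M ⊗ M^*) → Hom(M, X ⊗ M)` on the image of `E`. -/
lemma whiskerLeft_eval {E : FinRep k H} (X M : FinRep k H) (f : E ⟶ M ⊗ Mᘁ) (g : E.V →ₗ[k] H)
    (hg : ∀ e, tensorDualEquivEnd k M.V (f.lin e) = M.ρ (g e)) (s : X.V ⊗[k] E.V) (m : M.V) :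
    tensorDualEquivHom k M.V (X.V ⊗[k] M.V)
        ((TensorProduct.assoc k X.V M.V (Module.Dual k M.V)).symm ((X ◁ f).lin s)) m =
      LinearMap.lTensor X.V (M.ρ.toLinearMap.flip m ∘ₗ g) s := by
  have h1 : ∀ (x : X.V) (t : M.V ⊗[k] Module.Dual k M.V),
      tensorDualEquivHom k M.V (X.V ⊗[k] M.V)
        ((TensorProduct.assoc k X.V M.V (Module.Dual k M.V)).symm (x ⊗ₜ t)) m =
      x ⊗ₜ tensorDualEquivEnd k M.V t m := by
    intro x t
    induction t with
    | zero => simp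
    | add a b ha hb => simp only [TensorProduct.tmul_add, map_add, LinearMap.add_apply, ha, hb]
    | tmul m f => simp
  rw [whiskerLeft_lin]
  induction s with
  | zero =>
    rw [map_zero, map_zero]
    exact LinearMap.congr_fun (map_zero (tensorDualEquivHom k M.V (X.V ⊗[k] M.V))) m
  | add a b ha hb =>
    refine Eq.trans ?_ (map_add (LinearMap.lTensor X.V (M.ρ.toLinearMap.flip m ∘ₗ g)) a b).symm
    rw [map_add, map_add, ← ha, ← hb]
    exact LinearMap.congr_fun (map_add (tensorDualEquivHom k M.V (X.V ⊗[k] M.V)) _ _) m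
  | tmul x e =>
    refine (h1 x (f.lin e)).trans ?_
    rw [hg]
    rfl

/-- If `e` acts on `X ⊗ M` as `h`, inserting `x` and `m` gives `h₁ x ⊗ h₂ m`. This is the origin of
the comultiplication in the half-braiding. -/
lemma evalHom_eval {E : FinRep k H} (X M : FinRep k H) (f : E ⟶ (X ⊗ M) ⊗ (X ⊗ M)ᘁ)
    (e : E.V) (h : H) (x : X.V) (m : M.V)
    (hh : tensorDualEquivEnd k (X.V ⊗[k] M.V) (f.lin e) = (X ⊗ M : FinRep k H).ρ h) :
    tensorDualEquivHom k M.V (X.V ⊗[k] M.V)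
        ((TensorProduct.assoc k X.V M.V (Module.Dual k M.V)).symm
          ((f ▷ X ≫ RelEnd.evalHom X M (X ⊗ M) ≫ (α_ X M Mᘁ).hom).lin (e ⊗ₜ x))) m =
      LinearMap.lTensor X.V (M.ρ.toLinearMap.flip m) (braidLin X (h ⊗ₜ x)) := by
  have h1 : (TensorProduct.assoc k X.V M.V (Module.Dual k M.V)).symm
      ((f ▷ X ≫ RelEnd.evalHom X M (X ⊗ M) ≫ (α_ X M Mᘁ).hom).lin (e ⊗ₜ x)) =
      (RelEnd.evalHom X M (X ⊗ M)).lin (f.lin e ⊗ₜ x) :=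
    (TensorProduct.assoc k X.V M.V (Module.Dual k M.V)).symm_apply_apply _
  rw [h1]
  refine (evalHom_lin X M (X ⊗ M) (f.lin e) x m).trans ?_
  refine (LinearMap.congr_fun hh (x ⊗ₜ m)).trans ?_
  rw [braidLin_eq_sum, map_sum]
  exact HopfAction.tensor_apply X.ρ M.ρ h x m

/-- Gives the equivariance of half-braiding, product and unit without Sweedler computations: after
an injective module map each agrees with a morphism of `Rep(H)`. -/
lemma comm_of_injective {A B C : FinRep k H} (i : B ⟶ C) (hi : Function.Injective i.lin) (j : A ⟶ C)
    (f : A.V →ₗ[k] B.V) (hf : ∀ a, i.lin (f a) = j.lin a) (h : H) :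
    f ∘ₗ A.ρ h = B.ρ h ∘ₗ f := by
  apply LinearMap.ext
  intro a
  apply hi
  change i.lin (f (A.ρ h a)) = i.lin (B.ρ h (f a))
  rw [hf, lin_apply, lin_apply, hf]

variable {Q : Type u} [Ring Q] [HopfAlgebra k Q]

/-- The coinvariants are the kernel of `F(h) = h₁ ⊗ p(h₂) - h ⊗ 1`, and `H ⊗ -` preserves kernels
over a field. So it suffices that `a₁ ⊗ a₂ ⊗ p(a₃) = a₁ ⊗ a₂ ⊗ 1`, which is `comul ⊗ id` applied to
the coinvariance of `a`, combined with coassociativity. -/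
lemma comul_mem_range (p : H →ₐc[k] Q) {a : H} (ha : a ∈ coinvariants p) :
    comul (R := k) a ∈ LinearMap.range ((coinvariants p).val.toLinearMap.lTensor H) := by
  let F : H →ₗ[k] H ⊗[k] Q :=
    (p : H →ₐ[k] Q).toLinearMap.lTensor H ∘ₗ comul - (TensorProduct.mk k H Q).flip 1
  have hF : Function.Exact (coinvariants p).val.toLinearMap F := by
    intro h
    constructor
    · intro hh
      exact ⟨⟨h, (mem_coinvariants p h).2 (sub_eq_zero.1 hh)⟩, rfl⟩
    · rintro ⟨b, rfl⟩
      exact sub_eq_zero.2 ((mem_coinvariants p _).1 b.2)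
  refine ((Module.Flat.lTensor_exact H hF) _).1 ?_
  rw [LinearMap.lTensor_sub, LinearMap.sub_apply, sub_eq_zero]
  have h1 := coassoc' (k := k) (fun x y z : H => x ⊗ₜ[k] (y ⊗ₜ[k] p z))
    (by intros; constructor <;> intros <;>
      simp [TensorProduct.add_tmul, TensorProduct.smul_tmul'])
    (by intros; constructor <;> intros <;>
      simp [TensorProduct.add_tmul, TensorProduct.tmul_add, ← TensorProduct.smul_tmul'])
    (by intros; constructor <;> intros <;>
      simp [TensorProduct.tmul_add]) a
  have h2 := congrArg ((TensorProduct.assoc k H H Q).toLinearMap ∘ₗ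
    LinearMap.rTensor Q (comul (R := k) (A := H))) ((mem_coinvariants p a).1 ha)
  have h3 : ∑ r ∈ sw k a, ∑ q ∈ sw k r.1, q.1 ⊗ₜ[k] (q.2 ⊗ₜ[k] p r.2) =
      ∑ r ∈ sw k a, r.1 ⊗ₜ[k] (r.2 ⊗ₜ[k] (1 : Q)) := by
    simpa [sw_spec, map_sum, TensorProduct.sum_tmul] using h2
  rw [h1] at h3
  simpa [sw_spec, map_sum, TensorProduct.tmul_sum] using h3

lemma braidLin_mem_range (p : H →ₐc[k] Q) (X : FinRep k H) (t : coinvariants p ⊗[k] X.V) :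
    braidLin X ((coinvariants p).val.toLinearMap.rTensor X.V t) ∈
      LinearMap.range ((coinvariants p).val.toLinearMap.lTensor X.V) := by
  induction t with
  | zero => simp
  | add a b ha hb => rw [map_add, map_add]; exact add_mem ha hb
  | tmul a x =>
    obtain ⟨s, hs⟩ := comul_mem_range p a.2
    refine ⟨LinearMap.rTensor (coinvariants p) (X.ρ.toLinearMap.flip x) s, ?_⟩
    rw [LinearMap.rTensor_tmul, braidLin_tmul]
    change _ = LinearMap.rTensor H (X.ρ.toLinearMap.flip x) (comul (a : H))
    rw [← hs, ← LinearMap.comp_apply, ← LinearMap.comp_apply, LinearMap.lTensor_comp_rTensor,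
      LinearMap.rTensor_comp_lTensor]

lemma lTensor_val_injective (p : H →ₐc[k] Q) (W : Type u) [AddCommGroup W] [Module k W] :
    Function.Injective ((coinvariants p).val.toLinearMap.lTensor W) :=
  Module.Flat.lTensor_preserves_injective_linearMap _ Subtype.val_injective

/-- The map `a ⊗ x ↦ a₁ x ⊗ a₂` on coinvariants. -/
def coinvariantBraid (p : H →ₐc[k] Q) (X : FinRep k H) :
    coinvariants p ⊗[k] X.V →ₗ[k] X.V ⊗[k] coinvariants p :=
  (LinearEquiv.ofInjective _ (lTensor_val_injective p X.V)).symm.toLinearMap ∘ₗ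
    (braidLin X ∘ₗ (coinvariants p).val.toLinearMap.rTensor X.V).codRestrict _
      (braidLin_mem_range p X)

/-- Since `X ⊗ H^{co p} → X ⊗ H` is injective, this determines the braid. The half-braiding
identities are checked in `X ⊗ H` through it. -/
lemma lTensor_coinvariantBraid (p : H →ₐc[k] Q) (X : FinRep k H) (t : coinvariants p ⊗[k] X.V) :
    (coinvariants p).val.toLinearMap.lTensor X.V (coinvariantBraid p X t) =
      braidLin X ((coinvariants p).val.toLinearMap.rTensor X.V t) :=
  congrArg Subtype.val ((LinearEquiv.ofInjective _ (lTensor_val_injective p X.V)).apply_symm_apply _)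

lemma coinvariantBraid_injective [FiniteDimensional k H] (p : H →ₐc[k] Q) (X : FinRep k H) :
    Function.Injective (coinvariantBraid p X) := by
  intro s t hst
  apply Module.Flat.rTensor_preserves_injective_linearMap (M := X.V)
    (coinvariants p).val.toLinearMap Subtype.val_injective
  apply braidLin_injective X
  rw [← lTensor_coinvariantBraid, ← lTensor_coinvariantBraid, hst]

variable [FiniteDimensional k H] [FiniteDimensional k Q]

/-- As maps `M → X ⊗ M`, both sides send `m` to `a₁ x ⊗ a₂ m` when `t = a ⊗ x`. -/
lemma coinvariantHom_braid (p : H →ₐc[k] Q) (X M : FinRep k H) (t : coinvariants p ⊗[k] X.V) :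
    (X ◁ coinvariantHom p M).lin (coinvariantBraid p X t) =
      (coinvariantHom p (X ⊗ M) ▷ X ≫ RelEnd.evalHom X M (X ⊗ M) ≫ (α_ X M Mᘁ).hom).lin t := by
  suffices h : (X ◁ coinvariantHom p M).lin ∘ₗ coinvariantBraid p X =
      (coinvariantHom p (X ⊗ M) ▷ X ≫ RelEnd.evalHom X M (X ⊗ M) ≫ (α_ X M Mᘁ).hom).lin from
    LinearMap.congr_fun h t
  apply TensorProduct.ext'
  intro a x
  apply (TensorProduct.assoc k X.V M.V (Module.Dual k M.V)).symm.injective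
  apply (tensorDualEquivHom k M.V (X.V ⊗[k] M.V)).injective
  apply LinearMap.ext
  intro m
  refine Eq.trans ?_ (evalHom_eval X M (coinvariantHom p (X ⊗ M)) a (a : H) x m
    (tensorDualEquivEnd_coinvariantHom p (X ⊗ M) a)).symm
  refine (whiskerLeft_eval X M (coinvariantHom p M) (coinvariants p).val.toLinearMap
    (tensorDualEquivEnd_coinvariantHom p M) _ m).trans ?_
  refine (LinearMap.congr_fun (LinearMap.lTensor_comp X.V (M.ρ.toLinearMap.flip m)
    (coinvariants p).val.toLinearMap) _).trans ?_
  exact congrArg (LinearMap.lTensor X.V (M.ρ.toLinearMap.flip m))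
    (lTensor_coinvariantBraid p X (a ⊗ₜ x))

lemma coinvariantHom_regular_injective (p : H →ₐc[k] Q) :
    Function.Injective (coinvariantHom p (regular k H)).lin :=
  fun _ _ h => Subtype.ext (actionTensor_regular_injective h)

/-- The defining equation of the half-braiding at `M = H` expresses the braid, followed by the
injective module map `X ◁ π_H`, as a morphism of `Rep(H)`. -/
lemma coinvariantBraid_comm (p : H →ₐc[k] Q) (X : FinRep k H) (h : H) :
    coinvariantBraid p X ∘ₗ (coinvariantRep p ⊗ X : FinRep k H).ρ h =
      (X ⊗ coinvariantRep p : FinRep k H).ρ h ∘ₗ coinvariantBraid p X :=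
  comm_of_injective (A := coinvariantRep p ⊗ X) (B := X ⊗ coinvariantRep p)
    (X ◁ coinvariantHom p (regular k H))
    (Module.Flat.lTensor_preserves_injective_linearMap _ (coinvariantHom_regular_injective p))
    _ (coinvariantBraid p X) (coinvariantHom_braid p X (regular k H)) h

/-- The bijection `a ⊗ x ↦ a₁ x ⊗ a₂` on coinvariants. -/
def coinvariantBraidEquiv (p : H →ₐc[k] Q) (X : FinRep k H) :
    coinvariants p ⊗[k] X.V ≃ₗ[k] X.V ⊗[k] coinvariants p :=
  -- Dimensions agree, so there is no need to show that the left inverse built from `S⁻¹` preserves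
  -- coinvariants.
  LinearMap.linearEquivOfInjective (coinvariantBraid p X) (coinvariantBraid_injective p X)
    (by rw [Module.finrank_tensorProduct, Module.finrank_tensorProduct, mul_comm])

/-- The half-braiding of the coinvariants. -/
def coinvariantBraidIso (p : H →ₐc[k] Q) (X : FinRep k H) :
    coinvariantRep p ⊗ X ≅ X ⊗ coinvariantRep p :=
  mkIso (X := coinvariantRep p ⊗ X) (Y := X ⊗ coinvariantRep p)
    (coinvariantBraidEquiv p X) (coinvariantBraid_comm p X)

end FinRep

/-! ### The coinvariants as an algebra in the Drinfeld center -/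

namespace FinRep

variable {k H : Type u} [Field k] [Ring H] [HopfAlgebra k H]
  {Q : Type u} [Ring Q] [HopfAlgebra k Q]

lemma coinvariantBraid_naturality (p : H →ₐc[k] Q) {X Y : FinRep k H} (f : X ⟶ Y)
    (t : coinvariants p ⊗[k] X.V) :
    coinvariantBraid p Y (LinearMap.lTensor (coinvariants p) f.lin t) =
      LinearMap.rTensor (coinvariants p) f.lin (coinvariantBraid p X t) := by
  apply lTensor_val_injective p Y.V
  rw [lTensor_coinvariantBraid, ← LinearMap.comp_apply (LinearMap.lTensor _ _),
    LinearMap.lTensor_comp_rTensor, ← LinearMap.rTensor_comp_lTensor, LinearMap.comp_apply,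
    lTensor_coinvariantBraid]
  induction t with
  | zero => simp
  | add a b ha hb => simp only [map_add, ha, hb]
  | tmul a x =>
    simp only [LinearMap.lTensor_tmul, LinearMap.rTensor_tmul, braidLin_eq_sum, map_sum, lin_apply]

/-- The hexagon is coassociativity: both sides become `a₁ x ⊗ a₂ y ⊗ a₃` in `(X ⊗ Y) ⊗ H`. -/
lemma coinvariantBraid_tensor (p : H →ₐc[k] Q) (X Y : FinRep k H) (a : coinvariants p) (x : X.V)
    (y : Y.V) :
    coinvariantBraid p (X ⊗ Y) (a ⊗ₜ[k] (x ⊗ₜ[k] y)) =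
      (TensorProduct.assoc k X.V Y.V (coinvariants p)).symm
        (LinearMap.lTensor X.V (coinvariantBraid p Y)
          (TensorProduct.assoc k X.V (coinvariants p) Y.V
            (coinvariantBraid p X (a ⊗ₜ x) ⊗ₜ y))) := by
  have h1 : ∀ t : X.V ⊗[k] (Y.V ⊗[k] coinvariants p),
      (coinvariants p).val.toLinearMap.lTensor (X.V ⊗[k] Y.V)
        ((TensorProduct.assoc k X.V Y.V (coinvariants p)).symm t) =
      (TensorProduct.assoc k X.V Y.V H).symm
        (LinearMap.lTensor X.V ((coinvariants p).val.toLinearMap.lTensor Y.V) t) := by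
    intro t
    induction t with
    | zero => simp
    | add a b ha hb => simp only [map_add, ha, hb]
    | tmul x t =>
    induction t with
    | zero => simp
    | add a b ha hb => simp only [map_add, TensorProduct.tmul_add, ha, hb]
    | tmul y a => simp
  have h2 : ∀ s : X.V ⊗[k] coinvariants p,
      LinearMap.lTensor X.V ((coinvariants p).val.toLinearMap.lTensor Y.V)
        (LinearMap.lTensor X.V (coinvariantBraid p Y)
          (TensorProduct.assoc k X.V (coinvariants p) Y.V (s ⊗ₜ y))) =
      LinearMap.lTensor X.V (braidLin Y) (TensorProduct.assoc k X.V H Y.V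
        ((coinvariants p).val.toLinearMap.lTensor X.V s ⊗ₜ y)) := by
    intro s
    induction s with
    | zero => simp
    | add a b ha hb => simp only [map_add, TensorProduct.add_tmul, ha, hb]
    | tmul x a =>
      simp only [TensorProduct.assoc_tmul, LinearMap.lTensor_tmul, lTensor_coinvariantBraid,
        LinearMap.rTensor_tmul]
  apply lTensor_val_injective p (X.V ⊗[k] Y.V)
  refine (lTensor_coinvariantBraid p (X ⊗ Y) (a ⊗ₜ[k] (x ⊗ₜ[k] y))).trans ?_
  rw [h1, h2, lTensor_coinvariantBraid]
  refine (braidLin_eq_sum (X ⊗ Y) _ _).trans ?_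
  have h3 : ∀ q : H × H, (X ⊗ Y : FinRep k H).ρ q.1 (x ⊗ₜ[k] y) ⊗ₜ[k] q.2 =
      ∑ r ∈ sw k q.1, ((X.ρ r.1 x ⊗ₜ[k] Y.ρ r.2 y) ⊗ₜ[k] q.2 : (X.V ⊗[k] Y.V) ⊗[k] H) := by
    intro q
    rw [← TensorProduct.sum_tmul]
    exact congrArg (fun z : X.V ⊗[k] Y.V => z ⊗ₜ[k] q.2) (HopfAction.tensor_apply X.ρ Y.ρ q.1 x y)
  refine (Finset.sum_congr rfl fun q _ => h3 q).trans ?_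
  refine (coassoc' (k := k)
    (fun a b c : H => ((X.ρ a x ⊗ₜ[k] Y.ρ b y) ⊗ₜ[k] c : (X.V ⊗[k] Y.V) ⊗[k] H))
    ?_ ?_ ?_ _).trans ?_
  · intros; constructor <;> intros <;>
      simp [TensorProduct.add_tmul, TensorProduct.smul_tmul']
  · intros; constructor <;> intros <;>
      simp [TensorProduct.add_tmul, TensorProduct.tmul_add, ← TensorProduct.smul_tmul']
  · intros; constructor <;> intros <;>
      simp [TensorProduct.tmul_add]
  · simp [TensorProduct.sum_tmul, braidLin_eq_sum, TensorProduct.tmul_sum]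

lemma coinvariantBraid_algebraMap (p : H →ₐc[k] Q) (X : FinRep k H) (c : k) (x : X.V) :
    coinvariantBraid p X (algebraMap k (coinvariants p) c ⊗ₜ[k] x) =
      (c • x) ⊗ₜ[k] algebraMap k (coinvariants p) 1 := by
  apply lTensor_val_injective p X.V
  rw [lTensor_coinvariantBraid, LinearMap.rTensor_tmul, braidLin_tmul]
  simp [Algebra.TensorProduct.one_def, Algebra.algebraMap_eq_smul_one,
    TensorProduct.smul_tmul']

/-- The product is a morphism of the center because `comul` is multiplicative: both sides are `a₁ b₁
x ⊗ a₂ b₂`. -/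
lemma coinvariantBraid_mul (p : H →ₐc[k] Q) (X : FinRep k H) (a b : coinvariants p) (x : X.V) :
    coinvariantBraid p X ((a * b) ⊗ₜ[k] x) =
      LinearMap.lTensor X.V (LinearMap.mul' k (coinvariants p))
        (TensorProduct.assoc k X.V (coinvariants p) (coinvariants p)
          (LinearMap.rTensor (coinvariants p) (coinvariantBraid p X)
            ((TensorProduct.assoc k (coinvariants p) X.V (coinvariants p)).symm
              (a ⊗ₜ coinvariantBraid p X (b ⊗ₜ x))))) := by
  have h1 : ∀ (t : X.V ⊗[k] coinvariants p) (b : coinvariants p),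
      (coinvariants p).val.toLinearMap.lTensor X.V
        (LinearMap.lTensor X.V (LinearMap.mul' k (coinvariants p))
          (TensorProduct.assoc k X.V (coinvariants p) (coinvariants p) (t ⊗ₜ b))) =
      LinearMap.lTensor X.V (LinearMap.mulRight k (b : H))
        ((coinvariants p).val.toLinearMap.lTensor X.V t) := by
    intro t b
    induction t with
    | zero => simp
    | add a b ha hb => simp only [map_add, TensorProduct.add_tmul, ha, hb]
    | tmul x a => simp
  have h2 : ∀ s : X.V ⊗[k] coinvariants p,
      (coinvariants p).val.toLinearMap.lTensor X.V
        (LinearMap.lTensor X.V (LinearMap.mul' k (coinvariants p))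
          (TensorProduct.assoc k X.V (coinvariants p) (coinvariants p)
            (LinearMap.rTensor (coinvariants p) (coinvariantBraid p X)
              ((TensorProduct.assoc k (coinvariants p) X.V (coinvariants p)).symm
                (a ⊗ₜ s))))) =
      LinearMap.lTensor X.V (LinearMap.mul' k H) (TensorProduct.assoc k X.V H H
        (LinearMap.rTensor H (braidLin X) ((TensorProduct.assoc k H X.V H).symm
          ((a : H) ⊗ₜ (coinvariants p).val.toLinearMap.lTensor X.V s)))) := by
    intro s
    induction s with
    | zero => simp
    | add a b ha hb => simp only [map_add, TensorProduct.tmul_add, ha, hb]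
    | tmul x b =>
      simp only [TensorProduct.assoc_symm_tmul, LinearMap.rTensor_tmul, h1,
        lTensor_coinvariantBraid, LinearMap.lTensor_tmul, AlgHom.toLinearMap_apply,
        Subalgebra.coe_val]
      generalize braidLin X ((a : H) ⊗ₜ x) = t
      induction t with
      | zero => simp
      | add a b ha hb => simp only [map_add, TensorProduct.add_tmul, ha, hb]
      | tmul x a => simp
  apply lTensor_val_injective p X.V
  rw [h2, lTensor_coinvariantBraid, lTensor_coinvariantBraid]
  simp only [LinearMap.rTensor_tmul, AlgHom.toLinearMap_apply, Subalgebra.coe_val,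
    Subalgebra.coe_mul, braidLin_eq_sum, TensorProduct.tmul_sum, map_sum,
    TensorProduct.assoc_symm_tmul, TensorProduct.sum_tmul, TensorProduct.assoc_tmul,
    LinearMap.lTensor_tmul, LinearMap.mul'_apply]
  rw [Finset.sum_comm]
  have := sw_mul (k := k) (LinearMap.mk₂ k (fun c d : H => X.ρ c x ⊗ₜ[k] d)
    (by intros; simp [TensorProduct.add_tmul]) (by intros; simp [TensorProduct.smul_tmul'])
    (by intros; simp [TensorProduct.tmul_add]) (by intros; simp)) (a : H) (b : H)
  refine this.trans (Finset.sum_congr rfl fun q _ => Finset.sum_congr rfl fun r _ => ?_)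
  change X.ρ (q.1 * r.1) x ⊗ₜ[k] (q.2 * r.2) = _
  rw [map_mul]
  rfl

variable [FiniteDimensional k H] [FiniteDimensional k Q]

/-- Multiplicativity of the action. It serves both for the equation defining the product and, at `M
= H`, for the equivariance of the product. -/
lemma coinvariantHom_mul (p : H →ₐc[k] Q) (M : FinRep k H)
    (t : coinvariants p ⊗[k] coinvariants p) :
    (coinvariantHom p M).lin (LinearMap.mul' k (coinvariants p) t) =
      ((coinvariantHom p M ⊗ₘ coinvariantHom p M) ≫ RelEnd.compHom M).lin t := by
  suffices h : (coinvariantHom p M).lin ∘ₗ LinearMap.mul' k (coinvariants p) =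
      ((coinvariantHom p M ⊗ₘ coinvariantHom p M) ≫ RelEnd.compHom M).lin from
    LinearMap.congr_fun h t
  apply TensorProduct.ext'
  intro a b
  apply (tensorDualEquivEnd k M.V).injective
  refine (tensorDualEquivEnd_coinvariantHom p M (a * b)).trans ?_
  refine Eq.trans ?_ (compHom_lin M ((coinvariantHom p M).lin a) ((coinvariantHom p M).lin b)).symm
  rw [tensorDualEquivEnd_coinvariantHom, tensorDualEquivEnd_coinvariantHom]
  exact map_mul M.ρ (a : H) (b : H)

lemma coinvariantHom_one (p : H →ₐc[k] Q) (M : FinRep k H) (c : k) :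
    (coinvariantHom p M).lin (algebraMap k (coinvariants p) c) = (η_ M Mᘁ).lin c := by
  suffices h : (coinvariantHom p M).lin ∘ₗ Algebra.linearMap k (coinvariants p) =
      (η_ M Mᘁ).lin from LinearMap.congr_fun h c
  apply LinearMap.ext_ring
  apply (tensorDualEquivEnd k M.V).injective
  refine (tensorDualEquivEnd_coinvariantHom p M (algebraMap k (coinvariants p) 1)).trans ?_
  refine Eq.trans ?_ tensorDualEquivEnd_coevaluation.symm
  simp

/-- The coinvariants as an object of the Drinfeld center. -/
def coinvariantCenter (p : H →ₐc[k] Q) : Center (FinRep k H) :=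
  ⟨coinvariantRep p,
    { β := coinvariantBraidIso p
      monoidal := fun X Y => by
        apply hom_ext
        apply TensorProduct.ext
        apply LinearMap.ext
        intro a
        exact TensorProduct.ext' fun x y => coinvariantBraid_tensor p X Y a x y
      naturality := fun f => by
        apply hom_ext
        apply LinearMap.ext
        exact fun t => coinvariantBraid_naturality p f t }⟩

/-- The product of the coinvariants. -/
def coinvariantMul (p : H →ₐc[k] Q) : coinvariantRep p ⊗ coinvariantRep p ⟶ coinvariantRep p :=
  ⟨LinearMap.mul' k (coinvariants p), fun h =>
    comm_of_injective (A := coinvariantRep p ⊗ coinvariantRep p) (B := coinvariantRep p)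
      (coinvariantHom p (regular k H)) (coinvariantHom_regular_injective p)
      ((coinvariantHom p (regular k H) ⊗ₘ coinvariantHom p (regular k H)) ≫
        RelEnd.compHom (regular k H)) (LinearMap.mul' k (coinvariants p)) (coinvariantHom_mul p _) h⟩

/-- The unit of the coinvariants. -/
def coinvariantOne (p : H →ₐc[k] Q) : 𝟙_ (FinRep k H) ⟶ coinvariantRep p :=
  ⟨Algebra.linearMap k (coinvariants p), fun h =>
    comm_of_injective (A := 𝟙_ (FinRep k H)) (B := coinvariantRep p)
      (coinvariantHom p (regular k H)) (coinvariantHom_regular_injective p)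
      (η_ (regular k H) (regular k H)ᘁ) (Algebra.linearMap k (coinvariants p)) (coinvariantHom_one p _) h⟩

instance (p : H →ₐc[k] Q) : MonObj (coinvariantCenter p) where
  one := ⟨coinvariantOne p, fun X => by
    apply hom_ext
    exact TensorProduct.ext' fun c x => coinvariantBraid_algebraMap p X c x⟩
  mul := ⟨coinvariantMul p, fun X => by
    apply hom_ext
    exact TensorProduct.ext_threefold fun a b x => coinvariantBraid_mul p X a b x⟩
  one_mul := by
    apply Center.ext
    apply hom_ext
    exact TensorProduct.ext' fun (c : k) (a : coinvariants p) =>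
      (Algebra.smul_def c a).symm
  mul_one := by
    apply Center.ext
    apply hom_ext
    refine TensorProduct.ext' fun (a : coinvariants p) (c : k) => ?_
    exact (Algebra.commutes c a).symm.trans (Algebra.smul_def c a).symm
  mul_assoc := by
    apply Center.ext
    apply hom_ext
    exact TensorProduct.ext_threefold fun (a b c : coinvariants p) => mul_assoc a b c

theorem coinvariantCenter_isRelativeAdjointAlgebra (p : H →ₐc[k] Q) :
    RelEnd.IsRelativeAdjointAlgebra (restrict p) (coinvariantCenter p) (coinvariantHom p) where
  isRelativeEnd := coinvariantHom_isRelativeEnd p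
  halfBraiding X M := hom_ext (LinearMap.ext fun t => coinvariantHom_braid p X M t)
  mul M := hom_ext (LinearMap.ext fun t => coinvariantHom_mul p M t)
  one M := hom_ext (LinearMap.ext fun c => coinvariantHom_one p M c)

/-- The relative adjoint algebra is isomorphic to the coinvariants, compatibly with the maps to
`M ⊗ M^*`. -/
lemma exists_equiv_coinvariants (p : H →ₐc[k] Q) {A : FinRep k H} {π : ∀ M : FinRep k H, A ⟶ M ⊗ Mᘁ}
    (h : letI := RelEnd.revAction (restrict p)
      RelEnd.IsRelativeEnd (RelEnd.internalHom (FinRep k H)) (RelEnd.prebalancing (restrict p)) A π) :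
    ∃ φ : A.V ≃ₗ[k] coinvariants p,
      (∀ h a, (φ (A.ρ h a) : H) = adjointAction (k := k) h (φ a : H)) ∧
      ∀ (M : FinRep k H) (a : A.V), tensorDualEquivEnd k M.V ((π M).lin a) = M.ρ (φ a : H) := by
  let := RelEnd.revAction (restrict p)
  have h0 := coinvariantHom_isRelativeEnd p
  obtain ⟨f, hf, -⟩ := h0.universal A π h.wedge
  obtain ⟨g, hg, -⟩ := h.universal _ _ h0.wedge
  -- Both composites are compatible with the universal wedges, as are the identities, so uniqueness
  -- makes `f` and `g` inverse.
  have hfg : f ≫ g = 𝟙 A := (h.universal A π h.wedge).unique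
    (fun M => (Category.assoc f g _).trans ((congrArg (f ≫ ·) (hg M)).trans (hf M))) (fun M => Category.id_comp _)
  have hgf : g ≫ f = 𝟙 _ := (h0.universal _ _ h0.wedge).unique
    (fun M => (Category.assoc g f _).trans ((congrArg (g ≫ ·) (hf M)).trans (hg M))) (fun M => Category.id_comp _)
  refine ⟨LinearEquiv.ofLinearMap f.lin g.lin (congrArg Hom.lin hgf) (congrArg Hom.lin hfg),
    fun h a => ?_, fun M a => ?_⟩
  · exact congrArg Subtype.val (lin_apply f h a)
  · rw [← hf M]
    exact tensorDualEquivEnd_coinvariantHom p M (f.lin a)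

end FinRep

end

/-! ### Existence, and the structure of an arbitrary relative adjoint algebra -/

theorem mainTheorem9 {k H Q : Type u} [Field k]
    [Ring H] [HopfAlgebra k H] [FiniteDimensional k H]
    [Ring Q] [HopfAlgebra k Q] [FiniteDimensional k Q]
    (p : H →ₐc[k] Q) (hp : Function.Surjective p) :
    (∃ (A : Center (FinRep k H)) (_ : MonObj A) (π : ∀ M : FinRep k H, A.1 ⟶ M ⊗ Mᘁ),
      RelEnd.IsRelativeAdjointAlgebra (FinRep.restrict p) A π) ∧
    ∀ (A : Center (FinRep k H)) [MonObj A] (π : ∀ M : FinRep k H, A.1 ⟶ M ⊗ Mᘁ),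
      RelEnd.IsRelativeAdjointAlgebra (FinRep.restrict p) A π →
      ∃ φ : A.1.V ≃ₗ[k] coinvariants p,
        (∀ (h : H) (a : A.1.V), (φ (A.1.ρ h a) : H) = adjointAction (k := k) h (φ a : H)) ∧
        (∀ a b : A.1.V, φ ((MonObj.mul (X := A)).f.lin (a ⊗ₜ[k] b)) = φ a * φ b) ∧
        φ ((MonObj.one (X := A)).f.lin (1 : k)) = 1 ∧
        (∀ (X : FinRep k H) (a : A.1.V) (x : X.V),
          LinearMap.lTensor X.V ((coinvariants p).val.toLinearMap ∘ₗ φ.toLinearMap)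
            ((A.2.β X).hom.lin (a ⊗ₜ[k] x)) =
          LinearMap.rTensor H (X.ρ.toLinearMap.flip x) (Coalgebra.comul (R := k) (φ a : H))) ∧
        (∀ (M : FinRep k H) (a : A.1.V),
          tensorDualEquivEnd k M.V ((π M).lin a) = M.ρ (φ a : H)) := by
  
  refine ⟨⟨FinRep.coinvariantCenter p, inferInstance, FinRep.coinvariantHom p,
    FinRep.coinvariantCenter_isRelativeAdjointAlgebra p⟩, ?_⟩
  intro A _ π hA
  obtain ⟨φ, hφ, hπ⟩ := FinRep.exists_equiv_coinvariants p hA.isRelativeEnd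
  refine ⟨φ, hφ, fun a b => ?_, ?_, fun X a x => ?_, hπ⟩
  · apply Subtype.ext
    -- Products are compared by their actions on `H`, where `π_H` turns the product of `A` into
    -- composition of endomorphisms.
    apply FinRep.regular_injective (k := k) (H := H)
    refine (hπ (FinRep.regular k H) _).symm.trans ?_
    have h1 := LinearMap.congr_fun (congrArg FinRep.Hom.lin (hA.mul (FinRep.regular k H))) (a ⊗ₜ[k] b)
    refine (congrArg (tensorDualEquivEnd k H) h1).trans ?_
    refine (FinRep.compHom_lin (FinRep.regular k H) _ _).trans ?_
    rw [hπ, hπ]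
    exact (map_mul (FinRep.regular k H).ρ (φ a : H) (φ b : H)).symm
  · apply Subtype.ext
    apply FinRep.regular_injective (k := k) (H := H)
    refine (hπ (FinRep.regular k H) _).symm.trans ?_
    have h1 := LinearMap.congr_fun (congrArg FinRep.Hom.lin (hA.one (FinRep.regular k H))) (1 : k)
    refine (congrArg (tensorDualEquivEnd k H) h1).trans ?_
    refine (tensorDualEquivEnd_coevaluation (k := k) (V := H)).trans ?_
    exact (map_one (FinRep.regular k H).ρ).symm
  · have h1 := LinearMap.congr_fun (congrArg FinRep.Hom.lin (hA.halfBraiding X (FinRep.regular k H))) (a ⊗ₜ[k] x)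
    have h2 := FinRep.whiskerLeft_eval X (FinRep.regular k H) (π (FinRep.regular k H))
      ((coinvariants p).val.toLinearMap ∘ₗ φ.toLinearMap) (hπ (FinRep.regular k H))
      ((A.2.β X).hom.lin (a ⊗ₜ[k] x)) (1 : H)
    have h3 := FinRep.evalHom_eval X (FinRep.regular k H) (π (X ⊗ FinRep.regular k H)) a (φ a : H) x (1 : H)
      (hπ (X ⊗ FinRep.regular k H) a)
    have h4 := h2.symm.trans ((congrArg (fun z => tensorDualEquivHom k H (X.V ⊗[k] H)
        ((TensorProduct.assoc k X.V H (Module.Dual k H)).symm z) (1 : H)) h1).trans h3)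
    -- The half-braiding equation was taken at `M = H` and evaluated at `1`. Acting on `1` returns
    -- the element of `H` itself, so `h4` becomes the explicit formula.
    have h5 : (FinRep.regular k H).ρ.toLinearMap.flip (1 : H) = LinearMap.id :=
      LinearMap.ext fun y => mul_one y
    rw [h5, LinearMap.lTensor_id, LinearMap.id_comp] at h4
    exact h4
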